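/- Let $\beta\in(0,1)$ and $\alpha\in(1,2]$, and let $G$ be the heat kernel of $\partial_t^\beta u=-(-\Delta)^{\alpha/2}u$ on $\mathbb R$ (Caputo derivative of order $\beta$ in time), i.e. $$G(t,x)=\frac1{2\pi}\int_{\mathbb R}e^{ix\xi}\,E_{\beta,1}\big(-t^\beta|\xi|^\alpha\big)\,d\xi ,\qquad t>0,\ x\in\mathbb R,$$ where $E_{\mu,\nu}(z)=\sum_{k\ge0}\frac{z^k}{\Gamma(\mu k+\nu)}$ is the two-parameter Mittag-Leffler function. Let $$(f\star g)(t,x)=\int_0^t\!\int_{\mathbb R}f(t-s,x-y)\,g(s,y)\,dy\,ds$$ denote space-time convolution, write $f^{\star(n+1)}$ for the space-time convolution $f\star\cdots\star f$ with $n+1$ factors, and for $\lambda\in\mathbb R\setminus\{0\}$ let $$\mathcal K(t,x)=\mathcal K(t,x;\lambda)=\sum_{n\ge0}\lambda^{2(n+1)}\,(G^2)^{\star(n+1)}(t,x)$$ (a series of nonnegative terms). Let $$\underline{\mathcal G}_{\alpha,\beta}(t,x)=\frac{C_{1,\alpha}\,t^\beta}{(t^{2\beta/\alpha}+x^2)^{(1+\alpha)/2}},\qquad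 C_{1,\alpha}=\frac{\Gamma(\alpha/2+1/2)}{\Gamma(\alpha/2)\,\Gamma(1/2)} .$$ Then there are constants $c_\star,c_\circ,\psi>0$ depending only on $\alpha$ and $\beta$ such that, for every $\lambda\neq0$, with $C_\star=c_\star\lambda^2$, $C_\circ=c_\circ\lambda^2$ and $\Psi=\psi\lambda^2$, the following hold for all $t>0$ and $x\in\mathbb R$. 1. If $\alpha<2$, then $$\mathcal K(t,x)\ \ge\ C_\star\,\underline{\mathcal G}_{\alpha,\beta}^2(t,x)\,E_{1-\frac\beta\alpha,\,1-\frac\beta\alpha}\big(\Psi\,t^{1-\beta/\alpha}\big).$$ 2. For all $\alpha\in(1,2]$, $$(1\star\mathcal K)(t,x)\ \ge\ C_\circ\,t^{1-\beta/\alpha}\,E_{1-\frac\beta\alpha,\,2-\frac\beta\alpha}\big(\Psi\,t^{1-\beta/\alpha}\big).$$ -/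

import Mathlib

open MeasureTheory
open scoped ENNReal

noncomputable section

namespace FracHeat

/-- The two-parameter Mittag-Leffler function
`E_{μ,ν}(z) = ∑_{k ≥ 0} z ^ k / Γ(μ k + ν)` (an entire series for `μ, ν > 0`). -/
def mittagLeffler (μ ν z : ℝ) : ℝ :=
  ∑' k : ℕ, z ^ k / Real.Gamma (μ * k + ν)

/-- The heat kernel of `∂_t^β u = -(-Δ)^{α/2} u` on `ℝ` (Caputo derivative in time, initial datum
the Dirac mass at `0`): the function whose spatial Fourier transform `∫ e^{-i ξ x} G(t, x) dx` is
the solution `E_{β,1}(-t^β |ξ|^α)` of the equation `∂_t^β v = -|ξ|^α v`, `v(0) = 1`.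
It is written through Fourier inversion, as a cosine integral because the symbol is even in `ξ`;
the integral converges absolutely for `t > 0`, `α > 1` and `0 < β < 1`. -/
def heatKernel (α β t x : ℝ) : ℝ :=
  (2 * Real.pi)⁻¹ * ∫ ξ : ℝ, Real.cos (x * ξ) * mittagLeffler β 1 (-(t ^ β * |ξ| ^ α))

/-- The normalizing constant `C_{1,α} = Γ(α/2 + 1/2) / (Γ(α/2) Γ(1/2))`. -/
def refConst (α : ℝ) : ℝ :=
  Real.Gamma (α / 2 + 1 / 2) / (Real.Gamma (α / 2) * Real.Gamma (1 / 2))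

/-- The lower reference kernel
`C_{1,α} t^β / (t^{2β/α} + x²)^{(1+α)/2}`. -/
def refKernel (α β t x : ℝ) : ℝ :=
  refConst α * t ^ β / (t ^ (2 * β / α) + x ^ 2) ^ ((1 + α) / 2)

/-- Space-time convolution of nonnegative functions,
`(f ⋆ g)(t, x) = ∫_0^t ∫_ℝ f(t - s, x - y) g(s, y) dy ds`. -/
def stConv (f g : ℝ → ℝ → ℝ≥0∞) (t x : ℝ) : ℝ≥0∞ :=
  ∫⁻ s in Set.Ioo 0 t, ∫⁻ y : ℝ, f (t - s) (x - y) * g s y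

/-- `stConvPow f n` is the space-time convolution `f ⋆ ⋯ ⋆ f` with `n + 1` factors. -/
def stConvPow (f : ℝ → ℝ → ℝ≥0∞) : ℕ → ℝ → ℝ → ℝ≥0∞
  | 0 => f
  | n + 1 => stConv (stConvPow f n) f

/-- The resolvent kernel
`K(t, x; l) = ∑_{n ≥ 0} l^{2(n+1)} (G²)^{⋆(n+1)}(t, x)`,
a series of nonnegative terms, taken in `[0, ∞]`. -/
def resolventKernel (α β l t x : ℝ) : ℝ≥0∞ :=
  ∑' n : ℕ, ENNReal.ofReal (l ^ (2 * (n + 1))) *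
    stConvPow (fun s y => ENNReal.ofReal (heatKernel α β s y ^ 2)) n t x

end FracHeat

end

noncomputable section

namespace FracHeat

open Filter Topology

/-! All series involved have nonnegative terms, so it suffices to bound `heatKernel` from below and
convolve the bounds. By scaling, the kernel reduces to its profile at time 1, the cosine transform
of ξ ↦ E_β(-|ξ|^α).

The substance is a profile tail bound of order |z|^(-(1+α)) when α < 2. The number E_β(-x) is a
limit of values of the implicit scheme `fracScheme`, each step of which takes a nonnegative
combination of data and earlier values and multiplies it by (1 + μ)⁻¹. This gives 0 ≤ E_β(-x) ≤ 1,
decay of order 1/x, and E_β(-x) = 1 - x/Γ(1+β) + O(x²). For μ = τ|ξ|^α with α/2 < 1, the factor (1 +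
μ)⁻¹ is a limit of nonnegative combinations of Gaussians, so every step preserves the class
`IsUnimodalSymbol`. Hence the profile is nonincreasing on the half line (`heatProfile_antitone`) and
nonnegative.

Its Gaussian averages satisfy θ(s) = ∫ profile(z) exp(-s z²) dz = 1 - c₁ s^(α/2) + O(s^α). In w θ(s)
- (1+w) θ(2s) + θ(3s) the constants cancel, and strict concavity of s ↦ s^(α/2) leaves a positive
multiple of s^(α/2) for a suitable w < 1. The corresponding test function is positive only beyond
some y, where the profile is at most its value at y; this bounds that value from below
(`exists_heatProfile_tail_ge`).

Each convolution with the squared bound yields a Beta integral and a factor t^(1-β/α) (`stConv_ge`).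
The resulting Gamma quotients become those of the Mittag-Leffler series after a geometric loss,
absorbed in ψ. The second claim needs only a kernel bound on |x| ≤ δ t^(β/α), valid also for α = 2,
because spatial masses multiply exactly under convolution. -/

/-! ### Coefficients of the powers of 1 - z -/

lemma multichoose_succ_eq (r : ℝ) (m : ℕ) :
    Ring.multichoose r (m + 1) = Ring.multichoose r m * (r + m) / (m + 1) := by
  have h1 := Ring.factorial_nsmul_multichoose_eq_ascPochhammer r (m + 1)
  have h2 := Ring.factorial_nsmul_multichoose_eq_ascPochhammer r m
  rw [ascPochhammer_succ_right, Polynomial.smeval_mul, ← h2] at h1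
  simp only [nsmul_eq_mul, Nat.factorial_succ, Nat.cast_mul, Polynomial.smeval_add,
    Polynomial.smeval_X, pow_one, Polynomial.smeval_natCast, pow_zero, mul_one] at h1
  have hf : (m.factorial : ℝ) ≠ 0 := by positivity
  have hm : (m : ℝ) + 1 ≠ 0 := by positivity
  rw [eq_div_iff hm]
  apply mul_left_cancel₀ hf
  push_cast at h1
  linarith

lemma multichoose_nonneg {r : ℝ} (hr : 0 ≤ r) (m : ℕ) : 0 ≤ Ring.multichoose r m := by
  induction m with
  | zero => simp
  | succ m ih => rw [multichoose_succ_eq]; positivity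

/-- Only the first factor -b of the rising product is negative. This sign makes the scheme weights
nonnegative, and also the coefficients of 1 - (1 - z)^b. -/
lemma multichoose_neg_succ_nonpos {b : ℝ} (h0 : 0 < b) (h1 : b < 1) (m : ℕ) :
    Ring.multichoose (-b) (m + 1) ≤ 0 := by
  induction m with
  | zero => rw [multichoose_succ_eq]; simp; linarith
  | succ m ih =>
    rw [multichoose_succ_eq]
    apply div_nonpos_of_nonpos_of_nonneg _ (by positivity)
    apply mul_nonpos_of_nonpos_of_nonneg ih
    push_cast
    have : (0 : ℝ) ≤ m := by positivity
    linarith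

/-- Vandermonde's identity at negated arguments: the product of (1 - z)^(-r) and (1 - z)^(-t). -/
lemma multichoose_add (r t : ℝ) (m : ℕ) :
    Ring.multichoose (r + t) m =
      ∑ j ∈ Finset.range (m + 1), Ring.multichoose r (m - j) * Ring.multichoose t j := by
  have h := Ring.add_choose_eq m (Commute.all (-t) (-r))
  rw [← neg_add, Ring.choose_neg'] at h
  simp only [Ring.choose_neg'] at h
  rw [Finset.Nat.sum_antidiagonal_eq_sum_range_succ
    (fun i j => (Int.negOnePow i • Ring.multichoose t i) *
      (Int.negOnePow j • Ring.multichoose r j))] at h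
  have hs : ∀ j ∈ Finset.range (m + 1), (Int.negOnePow (j : ℕ) • Ring.multichoose t j) *
      (Int.negOnePow ((m - j : ℕ)) • Ring.multichoose r (m - j)) =
      Int.negOnePow m • (Ring.multichoose r (m - j) * Ring.multichoose t j) := by
    intro j hj
    have hj' : j ≤ m := Nat.lt_succ_iff.mp (Finset.mem_range.mp hj)
    rw [smul_mul_smul_comm, ← Int.negOnePow_add, mul_comm]
    congr 2
    push_cast [hj']
    ring
  rw [Finset.sum_congr rfl hs, ← Finset.smul_sum] at h
  rw [add_comm r t]
  exact MulAction.injective (Int.negOnePow (m : ℤ)) h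

lemma multichoose_one_add_le_pow {s : ℝ} (hs : 0 ≤ s) (m : ℕ) :
    Ring.multichoose (1 + s) m ≤ (1 + s) ^ m := by
  induction m with
  | zero => simp
  | succ m ih =>
    rw [multichoose_succ_eq, mul_div_assoc, pow_succ]
    gcongr
    rw [div_le_iff₀ (by positivity)]
    have : (0 : ℝ) ≤ m := by positivity
    nlinarith [mul_nonneg hs this]

/-- The first J factors are bounded crudely; each later ratio 1 + s/(n+1) is at most ((n+1)/n)^s.
For fixed J the prefactor is polynomial in s, which allows domination uniformly in n. -/
lemma multichoose_one_add_le {s : ℝ} (hs : 0 ≤ s) {J n : ℕ} (hJ : 0 < J) (hn : J ≤ n) :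
    Ring.multichoose (1 + s) n ≤ (1 + s) ^ J * ((n : ℝ) / J) ^ s := by
  have hJ' : (0 : ℝ) < J := by exact_mod_cast hJ
  induction n, hn using Nat.le_induction with
  | base => rw [div_self hJ'.ne', Real.one_rpow, mul_one]; exact multichoose_one_add_le_pow hs J
  | succ n hn ih =>
    have hn0 : (0 : ℝ) < n := hJ'.trans_le (by exact_mod_cast hn)
    rw [multichoose_succ_eq, mul_div_assoc]
    have e : ((n + 1 : ℕ) : ℝ) / J = (n / J) * ((n + 1) / n) := by
      push_cast; field_simp
    rw [e, Real.mul_rpow (by positivity) (by positivity), ← mul_assoc]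
    gcongr
    rw [Real.rpow_def_of_pos (by positivity)]
    have h1 := Real.one_sub_inv_le_log_of_pos (x := ((n : ℝ) + 1) / n) (by positivity)
    have h2 := Real.add_one_le_exp (Real.log (((n : ℝ) + 1) / n) * s)
    refine le_trans ?_ h2
    have h3 := mul_le_mul_of_nonneg_right h1 hs
    refine le_trans (le_of_eq ?_) (add_le_add h3 le_rfl)
    field_simp
    ring

lemma multichoose_mul_factorial (r : ℝ) (n : ℕ) :
    Ring.multichoose r n * n.factorial = ∏ j ∈ Finset.range n, (r + j) := by
  induction n with
  | zero => simp
  | succ n ih =>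
    rw [Finset.prod_range_succ, ← ih, multichoose_succ_eq, Nat.factorial_succ]
    push_cast
    field_simp

/-- Euler's limit formula for Γ(1 + s), inverted. -/
lemma tendsto_rpow_neg_mul_multichoose {s : ℝ} (hs : 0 ≤ s) :
    Tendsto (fun n : ℕ => (n : ℝ) ^ (-s) * Ring.multichoose (1 + s) n) atTop
      (𝓝 (Real.Gamma (1 + s))⁻¹) := by
  have h1 := (Real.GammaSeq_tendsto_Gamma (1 + s)).inv₀
    (Real.Gamma_pos_of_pos (by linarith)).ne'
  have h2 : Tendsto (fun n : ℕ => (n : ℝ) / (n + (1 + s))) atTop (𝓝 1) :=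
    tendsto_natCast_div_add_atTop (1 + s)
  have h3 := h2.mul h1
  rw [one_mul] at h3
  refine h3.congr' ?_
  filter_upwards [eventually_gt_atTop 0] with n hn
  have hn' : (0 : ℝ) < n := by exact_mod_cast hn
  have hp := multichoose_mul_factorial (1 + s) (n + 1)
  rw [multichoose_succ_eq, Nat.factorial_succ] at hp
  push_cast at hp
  rw [Real.GammaSeq, ← hp, Real.rpow_neg hn'.le, Real.rpow_add hn', Real.rpow_one]
  have : (0 : ℝ) < (n : ℝ) ^ s := by positivity
  have : (0 : ℝ) < n.factorial := by positivity
  field_simp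
  ring

/-! ### The implicit fractional scheme -/

/-- The Grünwald–Letnikov scheme for `∂^b v = -μ v`, `v(0) = 1`: the coefficients of
`(1 - z)^(b - 1) / ((1 - z)^b + μ)`. -/
def fracScheme (b μ : ℝ) : ℕ → ℝ
  | m => (1 + μ)⁻¹ * (Ring.multichoose (1 - b) m +
      ∑ j : Fin m, (-Ring.multichoose (-b) (m - j)) * fracScheme b μ j)

lemma fracScheme_eq (b μ : ℝ) (m : ℕ) :
    fracScheme b μ m = (1 + μ)⁻¹ * (Ring.multichoose (1 - b) m +
      ∑ j ∈ Finset.range m, (-Ring.multichoose (-b) (m - j)) * fracScheme b μ j) := by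
  rw [fracScheme, Finset.sum_range
    (f := fun j => (-Ring.multichoose (-b) (m - j)) * fracScheme b μ j)]

lemma fracScheme_zero (b μ : ℝ) : fracScheme b μ 0 = (1 + μ)⁻¹ := by
  rw [fracScheme_eq]; simp

lemma neg_multichoose_neg_nonneg {b : ℝ} (h0 : 0 < b) (h1 : b < 1) {m j : ℕ} (h : j < m) :
    0 ≤ -Ring.multichoose (-b) (m - j) := by
  obtain ⟨k, hk⟩ := Nat.exists_eq_add_of_lt h
  rw [show m - j = k + 1 by omega, neg_nonneg]
  exact multichoose_neg_succ_nonpos h0 h1 k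

lemma fracScheme_nonneg {b μ : ℝ} (h0 : 0 < b) (h1 : b < 1) (hμ : 0 ≤ μ) (m : ℕ) :
    0 ≤ fracScheme b μ m := by
  induction m using Nat.strong_induction_on with
  | _ m ih =>
    rw [fracScheme_eq]
    refine mul_nonneg (by positivity) (add_nonneg (multichoose_nonneg (by linarith) _)
      (Finset.sum_nonneg fun j hj => mul_nonneg ?_ (ih j (Finset.mem_range.mp hj))))
    exact neg_multichoose_neg_nonneg h0 h1 (Finset.mem_range.mp hj)

lemma fracScheme_mul {b μ : ℝ} (hμ : 0 ≤ μ) (m : ℕ) :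
    (1 + μ) * fracScheme b μ m = Ring.multichoose (1 - b) m +
      ∑ j ∈ Finset.range m, (-Ring.multichoose (-b) (m - j)) * fracScheme b μ j := by
  rw [fracScheme_eq b μ m, mul_inv_cancel_left₀ (by positivity)]

/-- Splitting off j = 0 in the recursion at m + 1 and shifting the rest lines it up with the
recursion at m. The difference consists of the nonpositive term `multichoose (-b) (m + 1)` times 1 -
v₀ and of increments that are nonpositive by induction. -/
lemma fracScheme_succ_le {b μ : ℝ} (h0 : 0 < b) (h1 : b < 1) (hμ : 0 ≤ μ) (m : ℕ) :
    fracScheme b μ (m + 1) ≤ fracScheme b μ m := by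
  induction m using Nat.strong_induction_on with
  | _ m ih =>
    have hp : Ring.multichoose (1 - b) (m + 1) =
        Ring.multichoose (-b) (m + 1) + Ring.multichoose (1 - b) m := by
      have := Ring.multichoose_succ_succ (-b) m
      rwa [neg_add_eq_sub] at this
    have e1 := fracScheme_mul (b := b) hμ m
    have e2 := fracScheme_mul (b := b) hμ (m + 1)
    rw [Finset.sum_range_succ', hp] at e2
    simp only [Nat.add_sub_add_right, Nat.sub_zero] at e2
    have hv : fracScheme b μ 0 ≤ 1 := by
      rw [fracScheme_zero]; exact inv_le_one_of_one_le₀ (by linarith)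
    have hb := multichoose_neg_succ_nonpos h0 h1 m
    have hs : ∑ j ∈ Finset.range m, (-Ring.multichoose (-b) (m - j)) * fracScheme b μ (j + 1) ≤
        ∑ j ∈ Finset.range m, (-Ring.multichoose (-b) (m - j)) * fracScheme b μ j :=
      Finset.sum_le_sum fun j hj => mul_le_mul_of_nonneg_left (ih j (Finset.mem_range.mp hj))
        (neg_multichoose_neg_nonneg h0 h1 (Finset.mem_range.mp hj))
    have hk : (1 + μ) * fracScheme b μ (m + 1) ≤ (1 + μ) * fracScheme b μ m := by
      nlinarith [mul_nonneg_of_nonpos_of_nonpos hb (sub_nonpos.mpr hv)]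
    exact le_of_mul_le_mul_left hk (by positivity)

lemma fracScheme_antitone {b μ : ℝ} (h0 : 0 < b) (h1 : b < 1) (hμ : 0 ≤ μ) :
    Antitone (fracScheme b μ) :=
  antitone_nat_of_succ_le (fracScheme_succ_le h0 h1 hμ)

lemma fracScheme_le_one {b μ : ℝ} (h0 : 0 < b) (h1 : b < 1) (hμ : 0 ≤ μ) (m : ℕ) :
    fracScheme b μ m ≤ 1 := by
  refine (fracScheme_antitone h0 h1 hμ (Nat.zero_le m)).trans ?_
  rw [fracScheme_zero]; exact inv_le_one_of_one_le₀ (by linarith)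

lemma summable_one_add_mul_pow_mul_pow {b q : ℝ} (h0 : 0 < b) (hq : 0 ≤ q) (hq1 : q < 1) (J : ℕ) :
    Summable fun k : ℕ => q ^ k * (1 + b * k) ^ J := by
  have hs := (summable_pow_mul_geometric_of_norm_lt_one J
    (r := q) (by rwa [Real.norm_of_nonneg hq])).mul_left ((1 + b) ^ J)
  rw [← summable_nat_add_iff 1] at hs ⊢
  refine Summable.of_nonneg_of_le (fun k => by positivity) (fun k => ?_) hs
  have : (1 + b * ((k + 1 : ℕ) : ℝ)) ≤ (1 + b) * ((k + 1 : ℕ) : ℝ) := by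
    push_cast
    have : (0 : ℝ) ≤ k := by positivity
    linarith
  calc q ^ (k + 1) * (1 + b * ((k + 1 : ℕ) : ℝ)) ^ J
      ≤ q ^ (k + 1) * ((1 + b) * ((k + 1 : ℕ) : ℝ)) ^ J := by gcongr
    _ = _ := by rw [mul_pow]; ring

lemma summable_neg_pow_mul_multichoose {b μ : ℝ} (h0 : 0 < b) (hμ : 0 ≤ μ) (hμ1 : μ < 1) (m : ℕ) :
    Summable fun k : ℕ => (-μ) ^ k * Ring.multichoose (1 + b * k) m := by
  refine Summable.of_norm_bounded (summable_one_add_mul_pow_mul_pow h0 hμ hμ1 m) fun k => ?_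
  rw [norm_mul, norm_pow, norm_neg, Real.norm_of_nonneg hμ,
    Real.norm_of_nonneg (multichoose_nonneg (by positivity) m)]
  gcongr
  exact multichoose_one_add_le_pow (by positivity) m

/-- Convolving the coefficients `∑ k, (-μ)^k * multichoose (1 + b k) m` with those of
`(1 - z)^(-r)` shifts the upper argument by `r`. -/
lemma sum_multichoose_mul_tsum {b μ : ℝ} (h0 : 0 < b) (hμ : 0 ≤ μ) (hμ1 : μ < 1) (r : ℝ) (m : ℕ) :
    ∑ j ∈ Finset.range (m + 1), Ring.multichoose r (m - j) *
      ∑' k : ℕ, (-μ) ^ k * Ring.multichoose (1 + b * k) j =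
      ∑' k : ℕ, (-μ) ^ k * Ring.multichoose (r + (1 + b * k)) m := by
  simp_rw [← tsum_mul_left]
  rw [← Summable.tsum_finsetSum]
  · refine tsum_congr fun k => ?_
    rw [multichoose_add, Finset.mul_sum]
    exact Finset.sum_congr rfl fun j _ => by ring
  · intro j _
    exact (summable_neg_pow_mul_multichoose h0 hμ hμ1 j).mul_left _

/-- For μ < 1 the generating function expands as ∑ (-μ)^k (1 - z)^(-1-bk). Multiplication by (1 -
z)^b lowers k by one, so the series satisfies the same recursion. -/
lemma fracScheme_eq_tsum {b μ : ℝ} (h0 : 0 < b) (hμ : 0 ≤ μ) (hμ1 : μ < 1)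
    (m : ℕ) : fracScheme b μ m = ∑' k : ℕ, (-μ) ^ k * Ring.multichoose (1 + b * k) m := by
  induction m using Nat.strong_induction_on with
  | _ m ih =>
    have e := sum_multichoose_mul_tsum h0 hμ hμ1 (-b) m
    rw [Finset.sum_range_succ, Nat.sub_self, Ring.multichoose_zero_right, one_mul] at e
    have hs := summable_neg_pow_mul_multichoose h0 hμ hμ1 m
    have hsh : ∀ k : ℕ, (-μ) ^ (k + 1) * Ring.multichoose (-b + (1 + b * ((k + 1 : ℕ) : ℝ))) m =
        (-μ) * ((-μ) ^ k * Ring.multichoose (1 + b * k) m) := by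
      intro k
      rw [show -b + (1 + b * ((k + 1 : ℕ) : ℝ)) = 1 + b * k by push_cast; ring]
      ring
    have hs' : Summable fun k : ℕ => (-μ) ^ k * Ring.multichoose (-b + (1 + b * k)) m := by
      rw [← summable_nat_add_iff 1]
      simp_rw [hsh]
      exact hs.mul_left _
    rw [hs'.tsum_eq_zero_add] at e
    simp_rw [hsh] at e
    rw [tsum_mul_left] at e
    have e2 := fracScheme_mul (b := b) hμ m
    rw [Finset.sum_congr rfl fun j hj => by rw [ih j (Finset.mem_range.mp hj)]] at e2
    simp only [neg_mul, Finset.sum_neg_distrib] at e2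
    simp only [pow_zero, one_mul, Nat.cast_zero, mul_zero, add_zero, neg_add_eq_sub] at e
    have : (1 + μ) * fracScheme b μ m =
        (1 + μ) * ∑' k : ℕ, (-μ) ^ k * Ring.multichoose (1 + b * k) m := by linarith
    exact mul_left_cancel₀ (by positivity) this

/-- The discrete Volterra form v + μ I^b v = 1, where I^b has the coefficients of (1 - z)^(-b). All
quantitative bounds on the scheme come from this identity. -/
lemma fracScheme_add_sum {b μ : ℝ} (h0 : 0 < b) (hμ : 0 ≤ μ) (hμ1 : μ < 1) (m : ℕ) :
    fracScheme b μ m +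
      μ * ∑ j ∈ Finset.range (m + 1), Ring.multichoose b (m - j) * fracScheme b μ j = 1 := by
  simp_rw [fracScheme_eq_tsum h0 hμ hμ1, sum_multichoose_mul_tsum h0 hμ hμ1]
  rw [(summable_neg_pow_mul_multichoose h0 hμ hμ1 m).tsum_eq_zero_add, ← tsum_mul_left]
  have : ∀ k : ℕ, (-μ) ^ (k + 1) * Ring.multichoose (1 + b * ((k + 1 : ℕ) : ℝ)) m =
      -(μ * ((-μ) ^ k * Ring.multichoose (b + (1 + b * k)) m)) := by
    intro k
    rw [show 1 + b * ((k + 1 : ℕ) : ℝ) = b + (1 + b * k) by push_cast; ring]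
    ring
  simp_rw [this]
  rw [tsum_neg]
  simp

lemma sum_multichoose (b : ℝ) (m : ℕ) :
    ∑ j ∈ Finset.range (m + 1), Ring.multichoose b (m - j) = Ring.multichoose (1 + b) m := by
  rw [add_comm 1 b, multichoose_add]
  simp

/-- Since v is nonincreasing, its fractional sum is at least v_m times the sum of the weights. -/
lemma fracScheme_mul_le_one {b μ : ℝ} (h0 : 0 < b) (h1 : b < 1) (hμ : 0 ≤ μ) (hμ1 : μ < 1)
    (m : ℕ) : fracScheme b μ m * (1 + μ * Ring.multichoose (1 + b) m) ≤ 1 := by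
  have h := fracScheme_add_sum h0 hμ hμ1 m
  have : fracScheme b μ m * Ring.multichoose (1 + b) m ≤
      ∑ j ∈ Finset.range (m + 1), Ring.multichoose b (m - j) * fracScheme b μ j := by
    rw [← sum_multichoose, Finset.mul_sum]
    refine Finset.sum_le_sum fun j hj => ?_
    rw [mul_comm]
    exact mul_le_mul_of_nonneg_left (fracScheme_antitone h0 h1 hμ
      (Nat.lt_succ_iff.mp (Finset.mem_range.mp hj))) (multichoose_nonneg h0.le _)
  nlinarith [mul_le_mul_of_nonneg_left this hμ]

lemma one_sub_le_fracScheme {b μ : ℝ} (h0 : 0 < b) (h1 : b < 1) (hμ : 0 ≤ μ) (hμ1 : μ < 1)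
    (m : ℕ) : 1 - μ * Ring.multichoose (1 + b) m ≤ fracScheme b μ m := by
  have h := fracScheme_add_sum h0 hμ hμ1 m
  have : ∑ j ∈ Finset.range (m + 1), Ring.multichoose b (m - j) * fracScheme b μ j ≤
      Ring.multichoose (1 + b) m := by
    rw [← sum_multichoose]
    exact Finset.sum_le_sum fun j hj => mul_le_of_le_one_right (multichoose_nonneg h0.le _)
      (fracScheme_le_one h0 h1 hμ j)
  nlinarith [mul_le_mul_of_nonneg_left this hμ]

lemma multichoose_one_add_mono {b : ℝ} (h0 : 0 < b) : Monotone (Ring.multichoose (1 + b)) := by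
  refine monotone_nat_of_le_succ fun m => ?_
  have := Ring.multichoose_succ_succ b m
  rw [add_comm 1 b, this]
  linarith [multichoose_nonneg h0.le (m + 1)]

/-- Second iteration of the Volterra identity: the first-order lower bound is inserted into the
fractional sum. -/
lemma fracScheme_le {b μ : ℝ} (h0 : 0 < b) (h1 : b < 1) (hμ : 0 ≤ μ) (hμ1 : μ < 1)
    (m : ℕ) : fracScheme b μ m ≤
      1 - μ * Ring.multichoose (1 + b) m + (μ * Ring.multichoose (1 + b) m) ^ 2 := by
  have h := fracScheme_add_sum h0 hμ hμ1 m
  have : Ring.multichoose (1 + b) m * (1 - μ * Ring.multichoose (1 + b) m) ≤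
      ∑ j ∈ Finset.range (m + 1), Ring.multichoose b (m - j) * fracScheme b μ j := by
    conv_lhs => rw [← sum_multichoose b m, Finset.sum_mul]
    refine Finset.sum_le_sum fun j hj => mul_le_mul_of_nonneg_left ?_ (multichoose_nonneg h0.le _)
    refine le_trans ?_ (one_sub_le_fracScheme h0 h1 hμ hμ1 j)
    have := multichoose_one_add_mono h0 (Nat.lt_succ_iff.mp (Finset.mem_range.mp hj))
    rw [sum_multichoose]
    nlinarith
  nlinarith [mul_le_mul_of_nonneg_left this hμ]

/-! ### Convergence to the Mittag-Leffler function -/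

/-- The scheme with `n` steps of length `1 / n` converges to the Mittag-Leffler function. -/
lemma tendsto_fracScheme {b x : ℝ} (h0 : 0 < b) (hx : 0 ≤ x) :
    Tendsto (fun n : ℕ => fracScheme b (x * (n : ℝ) ^ (-b)) n) atTop
      (𝓝 (mittagLeffler b 1 (-x))) := by
  have hlim : Tendsto (fun n : ℕ => x * (n : ℝ) ^ (-b)) atTop (𝓝 0) := by
    simpa using ((tendsto_rpow_neg_atTop h0).comp tendsto_natCast_atTop_atTop).const_mul x
  -- J is fixed so large that x J^(-b) < 1; this is the ratio of the dominating series, valid for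
  -- all n ≥ J.
  obtain ⟨J, hJ⟩ := ((hlim.eventually_lt_const zero_lt_one).and (eventually_gt_atTop 0)).exists
  obtain ⟨hJ1, hJ0⟩ := hJ
  have hJp : (0 : ℝ) < J := by exact_mod_cast hJ0
  have key : Tendsto (fun n : ℕ => ∑' k : ℕ, (-(x * (n : ℝ) ^ (-b))) ^ k *
      Ring.multichoose (1 + b * k) n) atTop (𝓝 (mittagLeffler b 1 (-x))) := by
    have hb := summable_one_add_mul_pow_mul_pow h0 (q := x * (J : ℝ) ^ (-b)) (by positivity) hJ1 J
    refine tendsto_tsum_of_dominated_convergence hb (fun k => ?_) ?_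
    · have := (tendsto_rpow_neg_mul_multichoose (s := b * k) (by positivity)).const_mul ((-x) ^ k)
      rw [add_comm (b * k) 1, div_eq_mul_inv]
      refine this.congr fun n => ?_
      rw [show -(b * k) = -b * (k : ℝ) by ring, Real.rpow_mul (by positivity), Real.rpow_natCast,
        ← neg_mul, mul_pow]
      ring
    · filter_upwards [eventually_ge_atTop J] with n hn k
      have hn0 : (0 : ℝ) < n := hJp.trans_le (by exact_mod_cast hn)
      rw [norm_mul, norm_pow, norm_neg, Real.norm_of_nonneg (by positivity : 0 ≤ x * (n : ℝ) ^ (-b)),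
        Real.norm_of_nonneg (multichoose_nonneg (by positivity) n)]
      have hm := multichoose_one_add_le (s := b * k) (by positivity) hJ0 hn
      calc (x * (n : ℝ) ^ (-b)) ^ k * Ring.multichoose (1 + b * k) n
          ≤ (x * (n : ℝ) ^ (-b)) ^ k * ((1 + b * k) ^ J * ((n : ℝ) / J) ^ (b * k)) := by gcongr
        _ = (x * (J : ℝ) ^ (-b)) ^ k * (1 + b * k) ^ J := by
          rw [Real.rpow_mul (by positivity), Real.rpow_natCast, Real.div_rpow hn0.le hJp.le,
            Real.rpow_neg hn0.le, Real.rpow_neg hJp.le]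
          have : (0 : ℝ) < (n : ℝ) ^ b := by positivity
          have : (0 : ℝ) < (J : ℝ) ^ b := by positivity
          rw [mul_left_comm, mul_comm, ← mul_pow]
          congr 2
          field_simp
  refine key.congr' ?_
  filter_upwards [hlim.eventually_lt_const zero_lt_one] with n hn
  rw [fracScheme_eq_tsum h0 (by positivity) hn]

lemma tendsto_mul_multichoose {b : ℝ} (h0 : 0 < b) (x : ℝ) :
    Tendsto (fun n : ℕ => x * (n : ℝ) ^ (-b) * Ring.multichoose (1 + b) n) atTop
      (𝓝 (x * (Real.Gamma (1 + b))⁻¹)) :=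
  ((tendsto_rpow_neg_mul_multichoose h0.le).const_mul x).congr fun n => by ring

lemma eventually_mul_rpow_neg_lt_one {b : ℝ} (h0 : 0 < b) (x : ℝ) :
    ∀ᶠ n : ℕ in atTop, x * (n : ℝ) ^ (-b) < 1 := by
  have hlim : Tendsto (fun n : ℕ => x * (n : ℝ) ^ (-b)) atTop (𝓝 0) := by
    simpa using ((tendsto_rpow_neg_atTop h0).comp tendsto_natCast_atTop_atTop).const_mul x
  exact hlim.eventually_lt_const zero_lt_one

lemma mittagLeffler_neg_nonneg {b x : ℝ} (h0 : 0 < b) (h1 : b < 1) (hx : 0 ≤ x) :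
    0 ≤ mittagLeffler b 1 (-x) :=
  ge_of_tendsto' (tendsto_fracScheme h0 hx) fun n => fracScheme_nonneg h0 h1 (by positivity) n

lemma mittagLeffler_neg_le_one {b x : ℝ} (h0 : 0 < b) (h1 : b < 1) (hx : 0 ≤ x) :
    mittagLeffler b 1 (-x) ≤ 1 :=
  le_of_tendsto' (tendsto_fracScheme h0 hx) fun n => fracScheme_le_one h0 h1 (by positivity) n

lemma mittagLeffler_neg_mul_le_one {b x : ℝ} (h0 : 0 < b) (h1 : b < 1) (hx : 0 ≤ x) :
    mittagLeffler b 1 (-x) * (1 + x * (Real.Gamma (1 + b))⁻¹) ≤ 1 := by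
  refine le_of_tendsto ((tendsto_fracScheme h0 hx).mul ((tendsto_mul_multichoose h0 x).const_add 1))
    ?_
  filter_upwards [eventually_mul_rpow_neg_lt_one h0 x] with n hn
  exact fracScheme_mul_le_one h0 h1 (by positivity) hn n

lemma abs_mittagLeffler_neg_sub_le {b x : ℝ} (h0 : 0 < b) (h1 : b < 1) (hx : 0 ≤ x) :
    |mittagLeffler b 1 (-x) - 1 + x * (Real.Gamma (1 + b))⁻¹| ≤
      (x * (Real.Gamma (1 + b))⁻¹) ^ 2 := by
  have t1 := tendsto_fracScheme h0 hx
  have t2 := tendsto_mul_multichoose h0 x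
  refine le_of_tendsto_of_tendsto ((t1.sub_const 1).add t2).abs (t2.pow 2) ?_
  filter_upwards [eventually_mul_rpow_neg_lt_one h0 x] with n hn
  have a1 := one_sub_le_fracScheme h0 h1 (by positivity) hn n
  have a2 := fracScheme_le h0 h1 (by positivity) hn n
  rw [abs_le]
  constructor <;> nlinarith [sq_nonneg (x * (n : ℝ) ^ (-b) * Ring.multichoose (1 + b) n)]

/-! ### Unimodal symbols and their multipliers -/

/-- Bounded symbols all of whose Gaussian regularizations have a cosine transform that is
nonincreasing on the half line. -/
def IsUnimodalSymbol (ψ : ℝ → ℝ) : Prop :=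
  Measurable ψ ∧ (∃ C, ∀ ξ, |ψ ξ| ≤ C) ∧ ∀ ε : ℝ, 0 < ε → ∀ z₁ z₂ : ℝ, 0 ≤ z₁ → z₁ ≤ z₂ →
    0 ≤ ∫ ξ : ℝ, (Real.cos (z₁ * ξ) - Real.cos (z₂ * ξ)) * Real.exp (-ε * ξ ^ 2) * ψ ξ

/-- Multipliers that preserve unimodal symbols. -/
def IsUnimodalMultiplier (φ : ℝ → ℝ) : Prop :=
  ∀ ψ, IsUnimodalSymbol ψ → IsUnimodalSymbol fun ξ => φ ξ * ψ ξ

lemma abs_cos_sub_cos_le (x y : ℝ) : |Real.cos x - Real.cos y| ≤ 2 := by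
  have h1 := Real.neg_one_le_cos x
  have h2 := Real.cos_le_one x
  have h3 := Real.neg_one_le_cos y
  have h4 := Real.cos_le_one y
  rw [abs_le]; constructor <;> linarith

lemma integrable_cos_sub_cos_mul {ψ : ℝ → ℝ} (hm : Measurable ψ) {C : ℝ} (hC : ∀ ξ, |ψ ξ| ≤ C)
    {ε : ℝ} (hε : 0 < ε) (z₁ z₂ : ℝ) :
    Integrable fun ξ : ℝ =>
      (Real.cos (z₁ * ξ) - Real.cos (z₂ * ξ)) * Real.exp (-ε * ξ ^ 2) * ψ ξ := by
  refine ((integrable_exp_neg_mul_sq hε).const_mul (2 * C)).mono' ?_ ?_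
  · fun_prop
  · refine Eventually.of_forall fun ξ => ?_
    rw [norm_mul, norm_mul, Real.norm_eq_abs, Real.norm_eq_abs, Real.norm_eq_abs, Real.abs_exp]
    calc _ ≤ 2 * Real.exp (-ε * ξ ^ 2) * C := by
          gcongr
          · exact abs_cos_sub_cos_le _ _
          · exact hC ξ
      _ = _ := by ring

lemma integral_cos_mul_gaussian {ε : ℝ} (hε : 0 < ε) (z : ℝ) :
    ∫ ξ : ℝ, Real.cos (z * ξ) * Real.exp (-ε * ξ ^ 2) =
      Real.sqrt (Real.pi / ε) * Real.exp (-z ^ 2 / (4 * ε)) := by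
  have h := fourierIntegral_gaussian (b := (ε : ℂ)) (by simpa using hε) (z : ℂ)
  have h2 := congrArg Complex.re h
  have e1 : (((Real.pi : ℂ) / ε) ^ (1 / 2 : ℂ) * Complex.exp (-(z : ℂ) ^ 2 / (4 * ε))) =
      ((Real.sqrt (Real.pi / ε) * Real.exp (-z ^ 2 / (4 * ε)) : ℝ) : ℂ) := by
    rw [Real.sqrt_eq_rpow]
    push_cast
    rw [Complex.ofReal_cpow (by positivity)]
    push_cast
    rfl
  rw [e1, Complex.ofReal_re] at h2
  rw [← h2, ← RCLike.re_eq_complex_re, ← integral_re]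
  · congr 1
    ext ξ
    have : Complex.exp (-(ε : ℂ) * (ξ : ℂ) ^ 2) = ((Real.exp (-ε * ξ ^ 2) : ℝ) : ℂ) := by
      push_cast; rfl
    rw [this, RCLike.re_eq_complex_re, Complex.re_mul_ofReal,
      show Complex.I * (z : ℂ) * (ξ : ℂ) = ((z * ξ : ℝ) : ℂ) * Complex.I by push_cast; ring,
      Complex.exp_ofReal_mul_I_re]
  · have := integrable_cexp_quadratic (b := (ε : ℂ)) (by simpa using hε) (Complex.I * z) 0
    refine this.congr (Eventually.of_forall fun ξ => ?_)
    simp only [← Complex.exp_add]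
    ring_nf

lemma isUnimodalSymbol_one : IsUnimodalSymbol fun _ => 1 := by
  refine ⟨measurable_const, ⟨1, by simp⟩, fun ε hε z₁ z₂ h0 h12 => ?_⟩
  simp only [mul_one, sub_mul]
  have hi : ∀ z : ℝ, Integrable fun ξ : ℝ => Real.cos (z * ξ) * Real.exp (-ε * ξ ^ 2) := by
    intro z
    refine (integrable_exp_neg_mul_sq hε).mono' (by fun_prop) (Eventually.of_forall fun ξ => ?_)
    rw [norm_mul, Real.norm_eq_abs, Real.norm_eq_abs, Real.abs_exp]
    exact mul_le_of_le_one_left (Real.exp_pos _).le (Real.abs_cos_le_one _)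
  rw [integral_sub (hi _) (hi _), integral_cos_mul_gaussian hε, integral_cos_mul_gaussian hε,
    sub_nonneg]
  gcongr

namespace IsUnimodalMultiplier

lemma symbol {φ : ℝ → ℝ} (h : IsUnimodalMultiplier φ) : IsUnimodalSymbol φ := by
  simpa using h _ isUnimodalSymbol_one

lemma mul {φ₁ φ₂ : ℝ → ℝ} (h₁ : IsUnimodalMultiplier φ₁) (h₂ : IsUnimodalMultiplier φ₂) :
    IsUnimodalMultiplier fun ξ => φ₁ ξ * φ₂ ξ := by
  intro ψ hψ
  simpa only [mul_assoc] using h₁ _ (h₂ ψ hψ)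

lemma const {c : ℝ} (hc : 0 ≤ c) : IsUnimodalMultiplier fun _ => c := by
  rintro ψ ⟨hm, ⟨C, hC⟩, hψ⟩
  refine ⟨hm.const_mul c, ⟨c * C, fun ξ => ?_⟩, fun ε hε z₁ z₂ h0 h12 => ?_⟩
  · rw [abs_mul, abs_of_nonneg hc]
    exact mul_le_mul_of_nonneg_left (hC ξ) hc
  · have := mul_nonneg hc (hψ ε hε z₁ z₂ h0 h12)
    rw [← integral_const_mul] at this
    exact this.trans_eq (integral_congr_ae (Eventually.of_forall fun ξ => by ring))

lemma add {φ₁ φ₂ : ℝ → ℝ} (h₁ : IsUnimodalMultiplier φ₁) (h₂ : IsUnimodalMultiplier φ₂) :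
    IsUnimodalMultiplier fun ξ => φ₁ ξ + φ₂ ξ := by
  intro ψ hψ
  obtain ⟨m₁, ⟨C₁, hC₁⟩, p₁⟩ := h₁ ψ hψ
  obtain ⟨m₂, ⟨C₂, hC₂⟩, p₂⟩ := h₂ ψ hψ
  simp only [add_mul]
  refine ⟨m₁.add m₂, ⟨C₁ + C₂, fun ξ => (abs_add_le _ _).trans (add_le_add (hC₁ ξ) (hC₂ ξ))⟩,
    fun ε hε z₁ z₂ h0 h12 => ?_⟩
  simp only [mul_add]
  rw [integral_add (integrable_cos_sub_cos_mul m₁ hC₁ hε z₁ z₂)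
    (integrable_cos_sub_cos_mul m₂ hC₂ hε z₁ z₂)]
  exact add_nonneg (p₁ ε hε z₁ z₂ h0 h12) (p₂ ε hε z₁ z₂ h0 h12)

lemma sum {ι : Type*} {s : Finset ι} {φ : ι → ℝ → ℝ} (h : ∀ i ∈ s, IsUnimodalMultiplier (φ i)) :
    IsUnimodalMultiplier fun ξ => ∑ i ∈ s, φ i ξ := by
  classical
  induction s using Finset.induction_on with
  | empty => simpa using const le_rfl
  | insert i s hi ih =>
    simp only [Finset.sum_insert hi]
    exact (h i (Finset.mem_insert_self _ _)).add
      (ih fun j hj => h j (Finset.mem_insert_of_mem hj))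

lemma pow {φ : ℝ → ℝ} (h : IsUnimodalMultiplier φ) (k : ℕ) :
    IsUnimodalMultiplier fun ξ => φ ξ ^ k := by
  induction k with
  | zero => simpa using const zero_le_one
  | succ k ih => simpa only [pow_succ] using ih.mul h

/-- The Gaussian merely changes the regularization from ε to ε + s; this is why unimodality is
required for every ε. -/
lemma gaussian {s : ℝ} (hs : 0 ≤ s) : IsUnimodalMultiplier fun ξ => Real.exp (-s * ξ ^ 2) := by
  rintro ψ ⟨hm, ⟨C, hC⟩, hψ⟩
  refine ⟨by fun_prop, ⟨C, fun ξ => ?_⟩, fun ε hε z₁ z₂ h0 h12 => ?_⟩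
  · rw [abs_mul, Real.abs_exp]
    refine le_trans ?_ (hC ξ)
    refine mul_le_of_le_one_left (abs_nonneg _) (Real.exp_le_one_iff.mpr ?_)
    nlinarith [mul_nonneg hs (sq_nonneg ξ)]
  · refine (hψ (ε + s) (by linarith) z₁ z₂ h0 h12).trans_eq
      (integral_congr_ae (Eventually.of_forall fun ξ => ?_))
    simp only
    rw [show -(ε + s) * ξ ^ 2 = -ε * ξ ^ 2 + -s * ξ ^ 2 by ring, Real.exp_add]
    ring

/-- Dominated convergence against the regularizing Gaussian. The point ξ = 0 is negligible, and the
binomial series below is summed only away from it. -/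
lemma of_tendsto {φ : ℕ → ℝ → ℝ} {φ' : ℝ → ℝ} {C : ℝ} (h : ∀ n, IsUnimodalMultiplier (φ n))
    (hC : ∀ n ξ, |φ n ξ| ≤ C) (hC' : ∀ ξ, |φ' ξ| ≤ C) (hm : Measurable φ')
    (hlim : ∀ ξ, ξ ≠ 0 → Tendsto (fun n => φ n ξ) atTop (𝓝 (φ' ξ))) :
    IsUnimodalMultiplier φ' := by
  rintro ψ ⟨hψm, ⟨D, hD⟩, hψ⟩
  have hC0 : 0 ≤ C := (abs_nonneg _).trans (hC' 0)
  refine ⟨hm.mul hψm, ⟨C * D, fun ξ => ?_⟩, fun ε hε z₁ z₂ h0 h12 => ?_⟩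
  · rw [abs_mul]
    exact mul_le_mul (hC' ξ) (hD ξ) (abs_nonneg _) hC0
  · refine ge_of_tendsto' (tendsto_integral_of_dominated_convergence
      (fun ξ => 2 * Real.exp (-ε * ξ ^ 2) * (C * D)) (fun n => ?_) ?_ (fun n => ?_) ?_)
      (fun n => ((h n) ψ ⟨hψm, ⟨D, hD⟩, hψ⟩).2.2 ε hε z₁ z₂ h0 h12)
    · have := ((h n) ψ ⟨hψm, ⟨D, hD⟩, hψ⟩).1
      refine Measurable.aestronglyMeasurable ?_
      exact Measurable.mul (by fun_prop) this
    · exact ((integrable_exp_neg_mul_sq hε).const_mul 2).mul_const _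
    · refine Eventually.of_forall fun ξ => ?_
      rw [norm_mul, norm_mul, norm_mul]
      simp only [Real.norm_eq_abs, Real.abs_exp]
      gcongr
      · exact abs_cos_sub_cos_le _ _
      · exact hC n ξ
      · exact hD ξ
    · have : ∀ᵐ ξ : ℝ, ξ ≠ 0 := by
        rw [ae_iff]
        simp
      filter_upwards [this] with ξ hξ
      exact ((hlim ξ hξ).mul_const _).const_mul _

end IsUnimodalMultiplier

lemma hasSum_multichoose_neg {a z : ℝ} (hz0 : 0 ≤ z) (hz1 : z < 1) :
    HasSum (fun n : ℕ => Ring.multichoose (-a) n * z ^ n) ((1 - z) ^ a) := by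
  have h := (Real.one_div_one_sub_rpow_hasFPowerSeriesOnBall_zero (-a)).hasSum (y := z) (by
    simp only [Metric.mem_eball, edist_zero_right]
    rw [Real.enorm_eq_ofReal hz0]
    simpa using hz1)
  simp only [FormalMultilinearSeries.ofScalars_apply_eq, smul_eq_mul, zero_add] at h
  rw [Real.rpow_neg (by linarith), one_div, inv_inv] at h
  simpa only [Ring.multichoose_eq] using h

lemma sum_neg_multichoose (a : ℝ) (N : ℕ) :
    ∑ j ∈ Finset.range N, -Ring.multichoose (-a) (j + 1) = 1 - Ring.multichoose (1 - a) N := by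
  induction N with
  | zero => simp
  | succ N ih =>
    rw [Finset.sum_range_succ, ih]
    have := Ring.multichoose_succ_succ (-a) N
    rw [neg_add_eq_sub] at this
    linarith

/-- For a < 1 the function 1 - (1 - z)^a is a power series in z with nonnegative coefficients; here
z is a Gaussian. -/
lemma isUnimodalMultiplier_one_sub_rpow {a s : ℝ} (ha0 : 0 < a) (ha1 : a < 1) (hs : 0 < s) :
    IsUnimodalMultiplier fun ξ => 1 - (1 - Real.exp (-s * ξ ^ 2)) ^ a := by
  have hz0 : ∀ ξ : ℝ, 0 ≤ Real.exp (-s * ξ ^ 2) := fun ξ => (Real.exp_pos _).le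
  have hz1 : ∀ ξ : ℝ, Real.exp (-s * ξ ^ 2) ≤ 1 := fun ξ => by
    rw [Real.exp_le_one_iff]; nlinarith [sq_nonneg ξ]
  refine IsUnimodalMultiplier.of_tendsto (C := 1) (φ := fun N ξ => ∑ j ∈ Finset.range N,
    -Ring.multichoose (-a) (j + 1) * Real.exp (-s * ξ ^ 2) ^ (j + 1)) (fun N => ?_)
    (fun N ξ => ?_) (fun ξ => ?_) (by fun_prop) (fun ξ hξ => ?_)
  · refine IsUnimodalMultiplier.sum fun j _ => IsUnimodalMultiplier.mul
      (IsUnimodalMultiplier.const ?_) ((IsUnimodalMultiplier.gaussian hs.le).pow _)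
    exact neg_nonneg.mpr (multichoose_neg_succ_nonpos ha0 ha1 j)
  · have hp : ∀ j, 0 ≤ -Ring.multichoose (-a) (j + 1) := fun j =>
      neg_nonneg.mpr (multichoose_neg_succ_nonpos ha0 ha1 j)
    rw [abs_of_nonneg (Finset.sum_nonneg fun j _ => mul_nonneg (hp j) (pow_nonneg (hz0 ξ) _))]
    calc _ ≤ ∑ j ∈ Finset.range N, -Ring.multichoose (-a) (j + 1) :=
          Finset.sum_le_sum fun j _ => mul_le_of_le_one_right (hp j)
            (pow_le_one₀ (hz0 ξ) (hz1 ξ))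
      _ ≤ 1 := by
        rw [sum_neg_multichoose]
        linarith [multichoose_nonneg (r := 1 - a) (by linarith) N]
  · have h1 : 0 ≤ (1 - Real.exp (-s * ξ ^ 2)) ^ a := Real.rpow_nonneg (by linarith [hz1 ξ]) _
    have h2 : (1 - Real.exp (-s * ξ ^ 2)) ^ a ≤ 1 :=
      Real.rpow_le_one (by linarith [hz1 ξ]) (by linarith [hz0 ξ]) ha0.le
    rw [abs_le]; constructor <;> linarith
  · have hlt : Real.exp (-s * ξ ^ 2) < 1 := by
      rw [Real.exp_lt_one_iff]
      have : 0 < ξ ^ 2 := by positivity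
      nlinarith
    have h := hasSum_multichoose_neg (a := a) (hz0 ξ) hlt
    rw [← hasSum_nat_add_iff' 1] at h
    have h2 := h.neg.tendsto_sum_nat
    simp only [Finset.range_one, Finset.sum_singleton, Ring.multichoose_zero_right, pow_zero,
      mul_one, neg_sub] at h2
    simpa only [neg_mul] using h2

/-- With B = 1 - (1 - exp(-sξ²))^a the denominator is (1 + κ) - κB, so the inverse is a geometric
series in B with nonnegative coefficients. -/
lemma isUnimodalMultiplier_inv_one_add_mul {a s κ : ℝ} (ha0 : 0 < a) (ha1 : a < 1) (hs : 0 < s)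
    (hκ : 0 ≤ κ) :
    IsUnimodalMultiplier fun ξ => (1 + κ * (1 - Real.exp (-s * ξ ^ 2)) ^ a)⁻¹ := by
  set B : ℝ → ℝ := fun ξ => 1 - (1 - Real.exp (-s * ξ ^ 2)) ^ a with hB
  have hBT := isUnimodalMultiplier_one_sub_rpow ha0 ha1 hs
  have hz1 : ∀ ξ : ℝ, Real.exp (-s * ξ ^ 2) ≤ 1 := fun ξ => by
    rw [Real.exp_le_one_iff]; nlinarith [sq_nonneg ξ]
  have hB1 : ∀ ξ, B ξ ≤ 1 := fun ξ => by
    have h1 : 0 ≤ (1 - Real.exp (-s * ξ ^ 2)) ^ a := Real.rpow_nonneg (by linarith [hz1 ξ]) _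
    simp only [hB]; linarith
  have hB0 : ∀ ξ, 0 ≤ B ξ := fun ξ => by
    have h2 : (1 - Real.exp (-s * ξ ^ 2)) ^ a ≤ 1 :=
      Real.rpow_le_one (by linarith [hz1 ξ]) (by linarith [Real.exp_pos (-s * ξ ^ 2)]) ha0.le
    simp only [hB]; linarith
  have hsum : ∀ ξ, HasSum (fun k : ℕ => (1 + κ)⁻¹ * ((κ / (1 + κ)) ^ k * B ξ ^ k))
      (1 + κ * (1 - Real.exp (-s * ξ ^ 2)) ^ a)⁻¹ := by
    intro ξ
    have hq : κ / (1 + κ) * B ξ < 1 := by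
      have : κ / (1 + κ) < 1 := by rw [div_lt_one (by positivity)]; linarith
      have h0 : 0 ≤ κ / (1 + κ) := by positivity
      nlinarith [hB0 ξ, hB1 ξ]
    have h := (hasSum_geometric_of_lt_one (mul_nonneg (by positivity) (hB0 ξ)) hq).mul_left
      (1 + κ)⁻¹
    simp only [mul_pow] at h
    have e : (1 + κ)⁻¹ * (1 - κ / (1 + κ) * B ξ)⁻¹ =
        (1 + κ * (1 - Real.exp (-s * ξ ^ 2)) ^ a)⁻¹ := by
      rw [← mul_inv]
      congr 1
      simp only [hB]
      field_simp
      ring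
    rwa [e] at h
  have hle : ∀ ξ, (1 + κ * (1 - Real.exp (-s * ξ ^ 2)) ^ a)⁻¹ ≤ 1 := fun ξ =>
    inv_le_one_of_one_le₀ (le_add_of_nonneg_right
      (mul_nonneg hκ (Real.rpow_nonneg (by linarith [hz1 ξ]) _)))
  have hn : ∀ ξ, ∀ k : ℕ, 0 ≤ (1 + κ)⁻¹ * ((κ / (1 + κ)) ^ k * B ξ ^ k) := fun ξ k =>
    mul_nonneg (by positivity) (mul_nonneg (by positivity) (pow_nonneg (hB0 ξ) k))
  refine IsUnimodalMultiplier.of_tendsto (C := 1) (φ := fun N ξ => ∑ k ∈ Finset.range N,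
    (1 + κ)⁻¹ * ((κ / (1 + κ)) ^ k * B ξ ^ k)) (fun N => ?_)
    (fun N ξ => ?_) (fun ξ => ?_) (by fun_prop) (fun ξ hξ => (hsum ξ).tendsto_sum_nat)
  · exact IsUnimodalMultiplier.sum fun j _ => (IsUnimodalMultiplier.const (by positivity)).mul
      ((IsUnimodalMultiplier.const (by positivity)).mul (hBT.pow _))
  · rw [abs_of_nonneg (Finset.sum_nonneg fun k _ => hn ξ k)]
    exact (sum_le_hasSum _ (fun k _ => hn ξ k) (hsum ξ)).trans (hle ξ)
  · rw [abs_of_nonneg ((hsum ξ).nonneg (hn ξ))]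
    exact hle ξ

lemma tendsto_mul_one_sub_exp (x : ℝ) :
    Tendsto (fun n : ℕ => ((n : ℝ) + 1) * (1 - Real.exp (-((n : ℝ) + 1)⁻¹ * x))) atTop (𝓝 x) := by
  have hd : HasDerivAt (fun t : ℝ => 1 - Real.exp (-t * x)) x 0 := by
    have h := (((hasDerivAt_id (0 : ℝ)).neg.mul_const x).exp).const_sub 1
    simpa using h
  have h1 := hd.tendsto_slope_zero
  have h2 : Tendsto (fun n : ℕ => ((n : ℝ) + 1)⁻¹) atTop (𝓝[≠] 0) := by
    refine tendsto_nhdsWithin_iff.mpr ⟨?_, Eventually.of_forall fun n => ?_⟩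
    · simpa using tendsto_one_div_add_atTop_nhds_zero_nat (𝕜 := ℝ)
    · have : (n : ℝ) + 1 ≠ 0 := by positivity
      simpa using this
  refine (h1.comp h2).congr fun n => ?_
  simp

lemma sq_rpow_half (ξ α : ℝ) : (ξ ^ 2) ^ (α / 2) = |ξ| ^ α := by
  rw [← sq_abs, ← Real.rpow_natCast, ← Real.rpow_mul (abs_nonneg _)]
  congr 1
  push_cast
  ring

/-- Approximation of ξ² by (n+1)(1 - exp(-ξ²/(n+1))). The exponent a = α/2 must be below 1, hence α
< 2. -/
lemma isUnimodalMultiplier_inv_one_add_abs_rpow {α τ : ℝ} (h0 : 0 < α) (h2 : α < 2) (hτ : 0 ≤ τ) :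
    IsUnimodalMultiplier fun ξ => (1 + |ξ| ^ α * τ)⁻¹ := by
  have hz1 : ∀ (n : ℕ) (ξ : ℝ), Real.exp (-((n : ℝ) + 1)⁻¹ * ξ ^ 2) ≤ 1 := fun n ξ => by
    rw [Real.exp_le_one_iff]
    have : 0 ≤ ((n : ℝ) + 1)⁻¹ * ξ ^ 2 := by positivity
    linarith
  have hb : ∀ x : ℝ, 0 ≤ x → |(1 + x)⁻¹| ≤ 1 := fun x hx => by
    rw [abs_of_nonneg (by positivity)]
    exact inv_le_one_of_one_le₀ (by linarith)
  refine IsUnimodalMultiplier.of_tendsto (C := 1) (φ := fun n ξ =>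
    (1 + (τ * ((n : ℝ) + 1) ^ (α / 2)) *
      (1 - Real.exp (-((n : ℝ) + 1)⁻¹ * ξ ^ 2)) ^ (α / 2))⁻¹) (fun n => ?_) (fun n ξ => ?_)
    (fun ξ => hb _ (by positivity)) (by fun_prop) (fun ξ hξ => ?_)
  · exact isUnimodalMultiplier_inv_one_add_mul (by linarith) (by linarith) (by positivity)
      (by positivity)
  · exact hb _ (mul_nonneg (by positivity) (Real.rpow_nonneg (by linarith [hz1 n ξ]) _))
  · have h := ((tendsto_mul_one_sub_exp (ξ ^ 2)).rpow_const (p := α / 2)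
      (Or.inr (by linarith))).const_mul τ
    have h3 := (h.const_add 1).inv₀ (by positivity)
    rw [sq_rpow_half, mul_comm τ] at h3
    refine h3.congr fun n => ?_
    rw [Real.mul_rpow (by positivity) (by linarith [hz1 n ξ]), mul_assoc]

lemma isUnimodalMultiplier_fracScheme {α b τ : ℝ} (h0 : 0 < α) (h2 : α < 2) (hb0 : 0 < b)
    (hb1 : b < 1) (hτ : 0 ≤ τ) (m : ℕ) :
    IsUnimodalMultiplier fun ξ => fracScheme b (|ξ| ^ α * τ) m := by
  induction m using Nat.strong_induction_on with
  | _ m ih =>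
    simp_rw [fracScheme_eq b _ m]
    refine (isUnimodalMultiplier_inv_one_add_abs_rpow h0 h2 hτ).mul
      ((IsUnimodalMultiplier.const (multichoose_nonneg (by linarith) m)).add
      (IsUnimodalMultiplier.sum fun j hj => (IsUnimodalMultiplier.const ?_).mul
        (ih j (Finset.mem_range.mp hj))))
    exact neg_multichoose_neg_nonneg hb0 hb1 (Finset.mem_range.mp hj)

/-! ### The heat kernel at time 1 -/

/-- The Fourier transform of the heat kernel at time `1`. -/
def heatSymbol (α b ξ : ℝ) : ℝ := mittagLeffler b 1 (-(|ξ| ^ α))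

lemma measurable_fracScheme (b : ℝ) (m : ℕ) : Measurable fun μ => fracScheme b μ m := by
  induction m using Nat.strong_induction_on with
  | _ m ih =>
    simp_rw [fracScheme_eq b _ m]
    refine Measurable.mul (by fun_prop) (measurable_const.add
      (Finset.measurable_fun_sum _ fun j hj => (ih j (Finset.mem_range.mp hj)).const_mul _))

lemma measurable_heatSymbol (α : ℝ) {b : ℝ} (hb0 : 0 < b) : Measurable (heatSymbol α b) := by
  refine measurable_of_tendsto_metrizable
    (f := fun (n : ℕ) (ξ : ℝ) => fracScheme b (|ξ| ^ α * (n : ℝ) ^ (-b)) n) (fun n => ?_)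
    (tendsto_pi_nhds.mpr fun ξ => tendsto_fracScheme hb0 (by positivity))
  exact (measurable_fracScheme b n).comp (by fun_prop)

lemma heatSymbol_nonneg (α ξ : ℝ) {b : ℝ} (hb0 : 0 < b) (hb1 : b < 1) : 0 ≤ heatSymbol α b ξ :=
  mittagLeffler_neg_nonneg hb0 hb1 (by positivity)

lemma heatSymbol_le_one (α ξ : ℝ) {b : ℝ} (hb0 : 0 < b) (hb1 : b < 1) : heatSymbol α b ξ ≤ 1 :=
  mittagLeffler_neg_le_one hb0 hb1 (by positivity)

lemma isUnimodalMultiplier_heatSymbol {α b : ℝ} (h0 : 0 < α) (h2 : α < 2) (hb0 : 0 < b)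
    (hb1 : b < 1) : IsUnimodalMultiplier (heatSymbol α b) := by
  refine IsUnimodalMultiplier.of_tendsto (C := 1)
    (fun n => isUnimodalMultiplier_fracScheme h0 h2 hb0 hb1 (τ := (n : ℝ) ^ (-b))
      (by positivity) n)
    (fun n ξ => ?_) (fun ξ => ?_) (measurable_heatSymbol α hb0)
    (fun ξ _ => tendsto_fracScheme hb0 (by positivity))
  · rw [abs_of_nonneg (fracScheme_nonneg hb0 hb1 (by positivity) n)]
    exact fracScheme_le_one hb0 hb1 (by positivity) n
  · rw [abs_of_nonneg (heatSymbol_nonneg α ξ hb0 hb1)]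
    exact heatSymbol_le_one α ξ hb0 hb1

/-- The symbol decays like |ξ|^(-α), and α > 1. -/
lemma integrable_heatSymbol {α b : ℝ} (h1 : 1 < α) (hb0 : 0 < b) (hb1 : b < 1) :
    Integrable (heatSymbol α b) := by
  set κ := (Real.Gamma (1 + b))⁻¹ with hκ
  have hκ0 : 0 < κ := inv_pos.mpr (Real.Gamma_pos_of_pos (by linarith))
  have hi : Integrable fun ξ : ℝ => (1 + ‖ξ‖) ^ (-α) :=
    integrable_one_add_norm (by simpa using h1)
  refine (hi.const_mul (2 ^ α * max 1 κ⁻¹)).mono' (measurable_heatSymbol α hb0).aestronglyMeasurable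
    (Eventually.of_forall fun ξ => ?_)
  rw [Real.norm_of_nonneg (heatSymbol_nonneg α ξ hb0 hb1), Real.norm_eq_abs]
  have h := mittagLeffler_neg_mul_le_one (x := |ξ| ^ α) hb0 hb1 (by positivity)
  rw [← hκ] at h
  change heatSymbol α b ξ * _ ≤ 1 at h
  set w := |ξ| with hw
  have hw0 : 0 ≤ w := abs_nonneg _
  have hwa : 0 ≤ w ^ α := by positivity
  have e1 : (1 + w) ^ α ≤ 2 ^ α * (1 + w ^ α) := by
    rcases le_total w 1 with hw1 | hw1
    · calc (1 + w) ^ α ≤ 2 ^ α := Real.rpow_le_rpow (by positivity) (by linarith) (by linarith)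
        _ ≤ _ := le_mul_of_one_le_right (by positivity) (by linarith)
    · calc (1 + w) ^ α ≤ (2 * w) ^ α :=
            Real.rpow_le_rpow (by positivity) (by linarith) (by linarith)
        _ = 2 ^ α * w ^ α := Real.mul_rpow (by norm_num) hw0
        _ ≤ _ := by gcongr; linarith
  have e2 : 1 + w ^ α ≤ max 1 κ⁻¹ * (1 + w ^ α * κ) := by
    have a1 : 1 ≤ max 1 κ⁻¹ := le_max_left _ _
    have a2 : 1 ≤ max 1 κ⁻¹ * κ := by
      have := mul_le_mul_of_nonneg_right (le_max_right 1 κ⁻¹) hκ0.le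
      rwa [inv_mul_cancel₀ hκ0.ne'] at this
    nlinarith [mul_le_mul_of_nonneg_left a2 hwa]
  have e3 : (1 + w) ^ α ≤ 2 ^ α * max 1 κ⁻¹ * (1 + w ^ α * κ) := by
    calc _ ≤ _ := e1
      _ ≤ 2 ^ α * (max 1 κ⁻¹ * (1 + w ^ α * κ)) := by gcongr
      _ = _ := by ring
  rw [Real.rpow_neg (by positivity), ← div_eq_mul_inv, le_div_iff₀ (by positivity)]
  calc heatSymbol α b ξ * (1 + w) ^ α
      ≤ heatSymbol α b ξ * (2 ^ α * max 1 κ⁻¹ * (1 + w ^ α * κ)) :=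
        mul_le_mul_of_nonneg_left e3 (heatSymbol_nonneg α ξ hb0 hb1)
    _ = 2 ^ α * max 1 κ⁻¹ * (heatSymbol α b ξ * (1 + w ^ α * κ)) := by ring
    _ ≤ 2 ^ α * max 1 κ⁻¹ := mul_le_of_le_one_right (by positivity) h

/-- The heat kernel at time `1`. -/
def heatProfile (α b z : ℝ) : ℝ :=
  (2 * Real.pi)⁻¹ * ∫ ξ : ℝ, Real.cos (z * ξ) * heatSymbol α b ξ

lemma integrable_cos_mul_heatSymbol {α b : ℝ} (h1 : 1 < α) (hb0 : 0 < b) (hb1 : b < 1) (z : ℝ) :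
    Integrable fun ξ : ℝ => Real.cos (z * ξ) * heatSymbol α b ξ :=
  (integrable_heatSymbol h1 hb0 hb1).bdd_mul (c := 1) (by fun_prop)
    (Eventually.of_forall fun ξ => by simpa using Real.abs_cos_le_one _)

lemma continuous_heatProfile {α b : ℝ} (h1 : 1 < α) (hb0 : 0 < b) (hb1 : b < 1) :
    Continuous (heatProfile α b) := by
  refine continuous_const.mul (continuous_of_dominated
    (fun z => (integrable_cos_mul_heatSymbol h1 hb0 hb1 z).aestronglyMeasurable) (fun z => ?_)
    (integrable_heatSymbol h1 hb0 hb1) (Eventually.of_forall fun ξ => by fun_prop))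
  refine Eventually.of_forall fun ξ => ?_
  rw [norm_mul, Real.norm_of_nonneg (heatSymbol_nonneg α ξ hb0 hb1), Real.norm_eq_abs]
  exact mul_le_of_le_one_left (heatSymbol_nonneg α ξ hb0 hb1) (Real.abs_cos_le_one _)

lemma heatProfile_neg (α b z : ℝ) : heatProfile α b (-z) = heatProfile α b z := by
  simp [heatProfile]

lemma heatProfile_abs (α b z : ℝ) : heatProfile α b |z| = heatProfile α b z := by
  rcases abs_choice z with h | h <;> rw [h]
  exact heatProfile_neg α b z

lemma heatProfile_antitone {α b : ℝ} (h1 : 1 < α) (h2 : α < 2) (hb0 : 0 < b) (hb1 : b < 1)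
    {z₁ z₂ : ℝ} (hz : 0 ≤ z₁) (hz' : z₁ ≤ z₂) : heatProfile α b z₂ ≤ heatProfile α b z₁ := by
  have hu := (isUnimodalMultiplier_heatSymbol (by linarith) h2 hb0 hb1).symbol
  refine mul_le_mul_of_nonneg_left ?_ (by positivity)
  rw [← sub_nonneg, ← integral_sub (integrable_cos_mul_heatSymbol h1 hb0 hb1 z₁)
    (integrable_cos_mul_heatSymbol h1 hb0 hb1 z₂)]
  refine ge_of_tendsto' (x := atTop) (f := fun n : ℕ => ∫ ξ : ℝ,
    (Real.cos (z₁ * ξ) - Real.cos (z₂ * ξ)) * Real.exp (-(1 / ((n : ℝ) + 1)) * ξ ^ 2) *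
      heatSymbol α b ξ) ?_ (fun n => hu.2.2 _ (by positivity) z₁ z₂ hz hz')
  refine tendsto_integral_of_dominated_convergence (fun ξ => 2 * heatSymbol α b ξ) (fun n => ?_)
    ((integrable_heatSymbol h1 hb0 hb1).const_mul 2) (fun n => ?_) ?_
  · have := measurable_heatSymbol α hb0
    exact Measurable.aestronglyMeasurable (by fun_prop)
  · refine Eventually.of_forall fun ξ => ?_
    rw [norm_mul, norm_mul, Real.norm_of_nonneg (heatSymbol_nonneg α ξ hb0 hb1)]
    simp only [Real.norm_eq_abs, Real.abs_exp]
    refine mul_le_mul_of_nonneg_right ?_ (heatSymbol_nonneg α ξ hb0 hb1)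
    have he : Real.exp (-(1 / ((n : ℝ) + 1)) * ξ ^ 2) ≤ 1 := by
      rw [Real.exp_le_one_iff]
      have : 0 ≤ 1 / ((n : ℝ) + 1) * ξ ^ 2 := by positivity
      linarith
    calc _ ≤ 2 * (1 : ℝ) := by gcongr; exact abs_cos_sub_cos_le _ _
      _ = 2 := mul_one 2
  · refine Eventually.of_forall fun ξ => ?_
    have ht : Tendsto (fun n : ℕ => Real.exp (-(1 / ((n : ℝ) + 1)) * ξ ^ 2)) atTop (𝓝 1) := by
      have h := ((tendsto_one_div_add_atTop_nhds_zero_nat (𝕜 := ℝ)).neg.mul_const (ξ ^ 2)).rexp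
      simpa using h
    have h := (ht.const_mul (Real.cos (z₁ * ξ) - Real.cos (z₂ * ξ))).mul_const (heatSymbol α b ξ)
    simpa only [mul_one, sub_mul] using h

/-- The value at 0 is a positive multiple of the integral of a nonnegative symbol that is positive
near 0 by the first-order expansion. -/
lemma heatProfile_zero_pos {α b : ℝ} (h1 : 1 < α) (hb0 : 0 < b) (hb1 : b < 1) :
    0 < heatProfile α b 0 := by
  refine mul_pos (by positivity) ?_
  simp only [zero_mul, Real.cos_zero, one_mul]
  rw [integral_pos_iff_support_of_nonneg (fun ξ => heatSymbol_nonneg α ξ hb0 hb1)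
    (integrable_heatSymbol h1 hb0 hb1)]
  set κ := (Real.Gamma (1 + b))⁻¹ with hκ
  have hκ0 : 0 < κ := inv_pos.mpr (Real.Gamma_pos_of_pos (by linarith))
  have hc : ContinuousAt (fun ξ : ℝ => |ξ| ^ α * κ + (|ξ| ^ α * κ) ^ 2) 0 := by
    have : Continuous fun ξ : ℝ => |ξ| ^ α :=
      continuous_abs.rpow_const fun _ => Or.inr (by linarith)
    fun_prop
  have hlt : ∀ᶠ ξ in 𝓝 (0 : ℝ), |ξ| ^ α * κ + (|ξ| ^ α * κ) ^ 2 < 1 := by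
    refine hc.eventually_lt_const ?_
    simp [Real.zero_rpow (show α ≠ 0 by linarith)]
  have hmem : Function.support (heatSymbol α b) ∈ 𝓝 (0 : ℝ) := by
    filter_upwards [hlt] with ξ hξ
    have h := abs_le.mp (abs_mittagLeffler_neg_sub_le (x := |ξ| ^ α) hb0 hb1 (by positivity))
    rw [← hκ] at h
    have : 0 < heatSymbol α b ξ := by
      simp only [heatSymbol]; linarith [h.1]
    exact this.ne'
  exact Measure.measure_pos_of_mem_nhds volume hmem

lemma heatKernel_eq_profile {α b t : ℝ} (h0 : 0 < α) (ht : 0 < t) (x : ℝ) :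
    heatKernel α b t x = t ^ (-(b / α)) * heatProfile α b (x * t ^ (-(b / α))) := by
  have hs : 0 < t ^ (b / α) := by positivity
  have h := Measure.integral_comp_mul_left
    (fun η : ℝ => Real.cos (x * t ^ (-(b / α)) * η) * heatSymbol α b η) (t ^ (b / α))
  rw [heatKernel, heatProfile, mul_left_comm]
  congr 1
  rw [abs_of_pos (inv_pos.mpr hs), smul_eq_mul, ← Real.rpow_neg ht.le] at h
  rw [← h]
  congr 1
  ext ξ
  rw [heatSymbol, abs_mul, abs_of_pos hs, Real.mul_rpow hs.le (abs_nonneg _), ← Real.rpow_mul ht.le,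
    div_mul_cancel₀ _ h0.ne', ← mul_assoc, mul_assoc x, ← Real.rpow_add ht]
  simp

/-- Riemann–Lebesgue. The points 2πn match the normalization exp(-2πi n ξ) of the Fourier character.
-/
lemma tendsto_heatProfile (α b : ℝ) (h1 : 1 < α) (hb0 : 0 < b) (hb1 : b < 1) :
    Tendsto (fun n : ℕ => heatProfile α b (2 * Real.pi * n)) atTop (𝓝 0) := by
  have h := Real.tendsto_integral_exp_smul_cocompact fun ξ => (heatSymbol α b ξ : ℂ)
  have h2 : Tendsto (fun n : ℕ => (n : ℝ)) atTop (cocompact ℝ) :=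
    tendsto_natCast_atTop_atTop.mono_right atTop_le_cocompact
  have h3 := ((Complex.continuous_re.tendsto _).comp (h.comp h2)).const_mul (2 * Real.pi)⁻¹
  simp only [Complex.zero_re, mul_zero] at h3
  refine h3.congr fun n => ?_
  rw [heatProfile]
  congr 1
  simp only [Function.comp_apply]
  rw [← RCLike.re_eq_complex_re, ← integral_re]
  · congr 1
    ext ξ
    rw [Circle.smul_def, smul_eq_mul, Real.fourierChar_apply, RCLike.re_eq_complex_re,
      Complex.re_mul_ofReal, Complex.exp_ofReal_mul_I_re, ← Real.cos_neg]
    ring_nf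
  · have hi : Integrable fun ξ => (heatSymbol α b ξ : ℂ) :=
      (integrable_heatSymbol h1 hb0 hb1).ofReal
    simpa [mul_comm] using (Real.fourierIntegral_convergent_iff (n : ℝ)).2 hi

/-- A function nonincreasing on the half line with limit 0 along a sequence tending to infinity is
nonnegative there. -/
lemma heatProfile_nonneg {α b : ℝ} (h1 : 1 < α) (h2 : α < 2) (hb0 : 0 < b) (hb1 : b < 1) (z : ℝ) :
    0 ≤ heatProfile α b z := by
  rw [← heatProfile_abs]
  refine le_of_tendsto (tendsto_heatProfile α b h1 hb0 hb1) ?_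
  have ht : Tendsto (fun n : ℕ => 2 * Real.pi * (n : ℝ)) atTop atTop :=
    tendsto_natCast_atTop_atTop.const_mul_atTop (by positivity)
  filter_upwards [ht.eventually_ge_atTop |z|] with n hn
  exact heatProfile_antitone h1 h2 hb0 hb1 (abs_nonneg z) hn

/-! ### Gaussian averages and the polynomial tail -/

lemma integrable_heatProfile_mul_gaussian {α b s : ℝ} (h1 : 1 < α) (hb0 : 0 < b) (hb1 : b < 1)
    (hs : 0 < s) : Integrable fun z => heatProfile α b z * Real.exp (-s * z ^ 2) := by
  refine (integrable_exp_neg_mul_sq hs).bdd_mul (c := (2 * Real.pi)⁻¹ * ∫ ξ, heatSymbol α b ξ)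
    (continuous_heatProfile h1 hb0 hb1).aestronglyMeasurable (Eventually.of_forall fun z => ?_)
  rw [heatProfile, norm_mul, Real.norm_of_nonneg (by positivity)]
  gcongr
  refine norm_integral_le_of_norm_le (integrable_heatSymbol h1 hb0 hb1)
    (Eventually.of_forall fun ξ => ?_)
  rw [norm_mul, Real.norm_of_nonneg (heatSymbol_nonneg α ξ hb0 hb1), Real.norm_eq_abs]
  exact mul_le_of_le_one_left (heatSymbol_nonneg α ξ hb0 hb1) (Real.abs_cos_le_one _)

/-- Parseval's identity through Fubini: small s concentrates the symbol average near ξ = 0, where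
its expansion is known. -/
lemma integral_heatProfile_mul_gaussian {α b s : ℝ} (h1 : 1 < α) (hb0 : 0 < b) (hb1 : b < 1)
    (hs : 0 < s) : ∫ z, heatProfile α b z * Real.exp (-s * z ^ 2) =
      (2 * Real.pi)⁻¹ * Real.sqrt (Real.pi / s) *
        ∫ ξ, heatSymbol α b ξ * Real.exp (-(4 * s)⁻¹ * ξ ^ 2) := by
  simp only [heatProfile, mul_assoc]
  rw [integral_const_mul]
  congr 1
  simp only [← integral_mul_const]
  rw [integral_integral_swap, ← integral_const_mul]
  · congr 1
    ext ξ
    have : ∀ z : ℝ, Real.cos (z * ξ) * heatSymbol α b ξ * Real.exp (-s * z ^ 2) =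
        heatSymbol α b ξ * (Real.cos (ξ * z) * Real.exp (-s * z ^ 2)) := fun z => by
      rw [mul_comm z ξ]; ring
    simp_rw [this]
    rw [integral_const_mul, integral_cos_mul_gaussian hs, mul_left_comm]
    congr 3
    field_simp
  · have hi : Integrable (fun p : ℝ × ℝ => Real.exp (-s * p.1 ^ 2) * heatSymbol α b p.2)
        (volume.prod volume) :=
      Integrable.mul_prod (integrable_exp_neg_mul_sq hs) (integrable_heatSymbol h1 hb0 hb1)
    have hb : Integrable (fun p : ℝ × ℝ => Real.cos (p.1 * p.2) *
        (Real.exp (-s * p.1 ^ 2) * heatSymbol α b p.2)) (volume.prod volume) :=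
      hi.bdd_mul (c := 1) (by fun_prop)
        (Eventually.of_forall fun p => by simpa using Real.abs_cos_le_one _)
    refine hb.congr (Eventually.of_forall fun p => ?_)
    simp only [Function.uncurry]
    ring

lemma integral_abs_rpow_mul_gaussian {q c : ℝ} (hq : -1 < q) (hc : 0 < c) :
    ∫ ξ : ℝ, |ξ| ^ q * Real.exp (-c * ξ ^ 2) =
      c ^ (-(q + 1) / 2) * Real.Gamma ((q + 1) / 2) := by
  have h := integral_comp_abs (f := fun x : ℝ => x ^ q * Real.exp (-c * x ^ (2 : ℝ)))
  rw [integral_rpow_mul_exp_neg_mul_rpow (by norm_num) hq hc] at h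
  simp only [Real.rpow_two, sq_abs] at h
  rw [h]
  ring

/-- The absolute moment of order `q` of the Gaussian density `exp (-η²) / √π`, times `2^q`. -/
def gaussianMoment (q : ℝ) : ℝ := 2 ^ q * Real.Gamma ((q + 1) / 2) / Real.sqrt Real.pi

lemma gaussianMoment_pos {q : ℝ} (hq : 0 ≤ q) : 0 < gaussianMoment q := by
  have := Real.Gamma_pos_of_pos (show 0 < (q + 1) / 2 by linarith)
  unfold gaussianMoment
  positivity

lemma gaussianMoment_zero : gaussianMoment 0 = 1 := by
  simp only [gaussianMoment, Real.rpow_zero, zero_add, one_mul, Real.Gamma_one_half_eq]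
  exact div_self (by positivity)

lemma mul_integral_abs_rpow_mul_gaussian {q s : ℝ} (hq : 0 ≤ q) (hs : 0 < s) :
    (2 * Real.pi)⁻¹ * Real.sqrt (Real.pi / s) *
      ∫ ξ : ℝ, |ξ| ^ q * Real.exp (-(4 * s)⁻¹ * ξ ^ 2) = gaussianMoment q * s ^ (q / 2) := by
  rw [integral_abs_rpow_mul_gaussian (by linarith) (by positivity), gaussianMoment,
    Real.inv_rpow (by positivity), ← Real.rpow_neg (by positivity),
    show -(-(q + 1) / 2) = q / 2 + 1 / 2 by ring, Real.rpow_add (by positivity),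
    ← Real.sqrt_eq_rpow, Real.mul_rpow (by norm_num) hs.le, Real.sqrt_mul (by norm_num),
    Real.sqrt_div Real.pi_pos.le, show (4 : ℝ) = 2 ^ (2 : ℝ) by norm_num,
    ← Real.rpow_mul (by norm_num), mul_div_cancel₀ q (two_ne_zero), Real.rpow_two,
    Real.sqrt_sq (by norm_num)]
  have h1 : 0 < Real.sqrt s := Real.sqrt_pos.mpr hs
  have h2 : 0 < Real.sqrt Real.pi := Real.sqrt_pos.mpr Real.pi_pos
  have h3 : Real.pi = Real.sqrt Real.pi * Real.sqrt Real.pi :=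
    (Real.mul_self_sqrt Real.pi_pos.le).symm
  rw [show (2 * Real.pi)⁻¹ = (2 * (Real.sqrt Real.pi * Real.sqrt Real.pi))⁻¹ by rw [← h3]]
  field_simp

lemma integrable_abs_rpow_mul_gaussian {q c : ℝ} (hq : 0 ≤ q) (hc : 0 < c) :
    Integrable fun ξ : ℝ => |ξ| ^ q * Real.exp (-c * ξ ^ 2) := by
  by_contra h
  -- A nonintegrable function would have integral 0 by convention, against the positive closed form.
  have h2 := integral_undef h
  rw [integral_abs_rpow_mul_gaussian (by linarith) hc] at h2
  have := Real.Gamma_pos_of_pos (show 0 < (q + 1) / 2 by linarith)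
  have : 0 < c ^ (-(q + 1) / 2) * Real.Gamma ((q + 1) / 2) := by positivity
  exact this.ne' h2

/-- Small-time expansion of the Gaussian averages of the heat symbol. -/
lemma abs_integral_heatProfile_sub_le {α b s : ℝ} (h1 : 1 < α) (hb0 : 0 < b) (hb1 : b < 1)
    (hs : 0 < s) :
    |(∫ z, heatProfile α b z * Real.exp (-s * z ^ 2)) - 1 +
        (Real.Gamma (1 + b))⁻¹ * gaussianMoment α * s ^ (α / 2)| ≤
      ((Real.Gamma (1 + b))⁻¹) ^ 2 * gaussianMoment (2 * α) * s ^ α := by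
  set κ := (Real.Gamma (1 + b))⁻¹
  set c := (4 * s)⁻¹ with hc
  have hc0 : 0 < c := by positivity
  set A := (2 * Real.pi)⁻¹ * Real.sqrt (Real.pi / s) with hA
  have hA0 : 0 ≤ A := by positivity
  have e0 := mul_integral_abs_rpow_mul_gaussian (q := 0) le_rfl hs
  have e1 := mul_integral_abs_rpow_mul_gaussian (q := α) (by linarith) hs
  have e2 := mul_integral_abs_rpow_mul_gaussian (q := 2 * α) (by linarith) hs
  rw [← hA, ← hc] at e0 e1 e2
  rw [gaussianMoment_zero, zero_div, Real.rpow_zero, one_mul] at e0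
  rw [mul_div_cancel_left₀ α two_ne_zero] at e2
  have i0 := integrable_abs_rpow_mul_gaussian (q := 0) le_rfl hc0
  have i1 := integrable_abs_rpow_mul_gaussian (q := α) (by linarith) hc0
  have i2 := integrable_abs_rpow_mul_gaussian (q := 2 * α) (by linarith) hc0
  have iφ : Integrable fun ξ => heatSymbol α b ξ * Real.exp (-c * ξ ^ 2) := by
    refine (integrable_exp_neg_mul_sq hc0).bdd_mul (c := 1)
      (measurable_heatSymbol α hb0).aestronglyMeasurable (Eventually.of_forall fun ξ => ?_)
    rw [Real.norm_of_nonneg (heatSymbol_nonneg α ξ hb0 hb1)]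
    exact heatSymbol_le_one α ξ hb0 hb1
  rw [integral_heatProfile_mul_gaussian h1 hb0 hb1 hs, ← hA, ← hc, mul_assoc κ, ← e1,
    mul_assoc (κ ^ 2), ← e2]
  conv_lhs => rw [← e0]
  have i3 : Integrable fun ξ => heatSymbol α b ξ * Real.exp (-c * ξ ^ 2) -
      |ξ| ^ (0 : ℝ) * Real.exp (-c * ξ ^ 2) := iφ.sub i0
  have e4 : (A * ∫ ξ, heatSymbol α b ξ * Real.exp (-c * ξ ^ 2)) -
      (A * ∫ ξ : ℝ, |ξ| ^ (0 : ℝ) * Real.exp (-c * ξ ^ 2)) +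
      κ * (A * ∫ ξ : ℝ, |ξ| ^ α * Real.exp (-c * ξ ^ 2)) =
      A * ∫ ξ : ℝ, (heatSymbol α b ξ * Real.exp (-c * ξ ^ 2) -
        |ξ| ^ (0 : ℝ) * Real.exp (-c * ξ ^ 2) + κ * (|ξ| ^ α * Real.exp (-c * ξ ^ 2))) := by
    rw [integral_add i3 (i1.const_mul κ), integral_sub iφ i0, integral_const_mul]
    ring
  rw [e4, abs_mul, abs_of_nonneg hA0, mul_left_comm (κ ^ 2), ← integral_const_mul (κ ^ 2)]
  refine mul_le_mul_of_nonneg_left ?_ hA0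
  rw [← Real.norm_eq_abs]
  refine norm_integral_le_of_norm_le (i2.const_mul _) (Eventually.of_forall fun ξ => ?_)
  have h := abs_mittagLeffler_neg_sub_le (x := |ξ| ^ α) hb0 hb1 (by positivity)
  have hr : heatSymbol α b ξ * Real.exp (-c * ξ ^ 2) -
        |ξ| ^ (0 : ℝ) * Real.exp (-c * ξ ^ 2) + κ * (|ξ| ^ α * Real.exp (-c * ξ ^ 2)) =
      (heatSymbol α b ξ - 1 + |ξ| ^ α * κ) * Real.exp (-c * ξ ^ 2) := by
    rw [Real.rpow_zero]; ring
  rw [hr, norm_mul, Real.norm_eq_abs, Real.norm_eq_abs, Real.abs_exp, ← mul_assoc]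
  refine mul_le_mul_of_nonneg_right (h.trans_eq ?_) (Real.exp_pos _).le
  rw [mul_pow, ← Real.rpow_natCast (|ξ| ^ α), ← Real.rpow_mul (abs_nonneg _)]
  push_cast
  rw [mul_comm α 2, mul_comm]

/-- Testing the profile against `u (1 - u) (w - u)`, `u = exp (-s z²)`: positive values are only
collected where `|z| ≥ y`. -/
lemma integral_combination_le {α b s w y : ℝ} (h1 : 1 < α) (h2 : α < 2) (hb0 : 0 < b) (hb1 : b < 1)
    (hs : 0 < s) (hw1 : w < 1) (hy : 0 ≤ y) (hw : Real.exp (-s * y ^ 2) = w) :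
    w * (∫ z, heatProfile α b z * Real.exp (-s * z ^ 2)) -
      (1 + w) * (∫ z, heatProfile α b z * Real.exp (-(2 * s) * z ^ 2)) +
      (∫ z, heatProfile α b z * Real.exp (-(3 * s) * z ^ 2)) ≤
    heatProfile α b y * Real.sqrt (Real.pi / s) := by
  have i1 := integrable_heatProfile_mul_gaussian (α := α) h1 hb0 hb1 hs
  have i2 := integrable_heatProfile_mul_gaussian (α := α) h1 hb0 hb1 (s := 2 * s) (by positivity)
  have i3 := integrable_heatProfile_mul_gaussian (α := α) h1 hb0 hb1 (s := 3 * s) (by positivity)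
  have i12 : Integrable fun z => w * (heatProfile α b z * Real.exp (-s * z ^ 2)) -
      (1 + w) * (heatProfile α b z * Real.exp (-(2 * s) * z ^ 2)) :=
    (i1.const_mul w).sub (i2.const_mul (1 + w))
  rw [← integral_gaussian s, ← integral_const_mul, ← integral_const_mul, ← integral_const_mul,
    ← integral_sub (i1.const_mul w) (i2.const_mul (1 + w)),
    ← integral_add i12 i3]
  refine integral_mono (i12.add i3)
    ((integrable_exp_neg_mul_sq hs).const_mul _) fun z => ?_
  simp only
  set u := Real.exp (-s * z ^ 2) with hu
  have hu0 : 0 < u := Real.exp_pos _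
  have e2 : Real.exp (-(2 * s) * z ^ 2) = u ^ 2 := by
    rw [hu, ← Real.exp_nat_mul]; congr 1; push_cast; ring
  have e3 : Real.exp (-(3 * s) * z ^ 2) = u ^ 3 := by
    rw [hu, ← Real.exp_nat_mul]; congr 1; push_cast; ring
  rw [e2, e3]
  have hz := heatProfile_nonneg h1 h2 hb0 hb1 z
  have hyn := heatProfile_nonneg h1 h2 hb0 hb1 y
  have hw0 : 0 < w := hw ▸ Real.exp_pos _
  rw [show w * (heatProfile α b z * u) - (1 + w) * (heatProfile α b z * u ^ 2) +
    heatProfile α b z * u ^ 3 = heatProfile α b z * ((1 - u) * (w - u)) * u by ring]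
  refine mul_le_mul_of_nonneg_right ?_ hu0.le
  have hu1 : u ≤ 1 := by
    rw [hu, Real.exp_le_one_iff]; nlinarith [sq_nonneg z]
  rcases le_total |z| y with hzy | hzy
  · have : w ≤ u := by
      rw [← hw, hu, Real.exp_le_exp]
      have : z ^ 2 ≤ y ^ 2 := by rw [← sq_abs]; gcongr
      nlinarith
    refine le_trans ?_ hyn
    exact mul_nonpos_of_nonneg_of_nonpos hz
      (mul_nonpos_of_nonneg_of_nonpos (by linarith) (by linarith))
  · have huw : u ≤ w := by
      rw [← hw, hu, Real.exp_le_exp]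
      have : y ^ 2 ≤ z ^ 2 := by rw [← sq_abs z]; gcongr
      nlinarith
    have hm : heatProfile α b z ≤ heatProfile α b y := by
      rw [← heatProfile_abs α b z]
      exact heatProfile_antitone h1 h2 hb0 hb1 hy hzy
    have : (1 - u) * (w - u) ≤ 1 := by nlinarith
    calc _ ≤ heatProfile α b z * 1 := mul_le_mul_of_nonneg_left this hz
      _ ≤ _ := by linarith

lemma exists_strictConcave_weight {a : ℝ} (h0 : 0 < a) (h1 : a < 1) :
    ∃ w : ℝ, 0 < w ∧ w < 1 ∧ 0 < (1 + w) * 2 ^ a - w - 3 ^ a := by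
  have hc : (1 : ℝ) + 3 ^ a < 2 * 2 ^ a := by
    have h := (Real.strictConcaveOn_rpow h0 h1).2
      (show (1 : ℝ) ∈ Set.Ici 0 by norm_num) (show (3 : ℝ) ∈ Set.Ici 0 by norm_num) (by norm_num)
      (show (0 : ℝ) < 1 / 2 by norm_num) (show (0 : ℝ) < 1 / 2 by norm_num) (by norm_num)
    simp only [smul_eq_mul, Real.one_rpow] at h
    norm_num at h
    linarith
  have h2 : (1 : ℝ) < 2 ^ a := Real.one_lt_rpow (by norm_num) h0
  have h3 : (1 : ℝ) < 3 ^ a := Real.one_lt_rpow (by norm_num) h0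
  have hd : (0 : ℝ) < 2 * (2 ^ a - 1) := by linarith
  -- The last condition reads w > (3^a - 2^a)/(2^a - 1), a threshold below 1 by concavity; the
  -- witness is the midpoint between it and 1.
  refine ⟨(3 ^ a - 1) / (2 * (2 ^ a - 1)), div_pos (by linarith) hd, ?_, ?_⟩
  · rw [div_lt_one hd]; linarith
  · have : (3 ^ a - 1 : ℝ) / (2 * (2 ^ a - 1)) * (2 ^ a - 1) = (3 ^ a - 1) / 2 := by
      have : (2 ^ a - 1 : ℝ) ≠ 0 := by linarith
      field_simp
    linarith

/-- The coefficients w, -(1+w), 1 sum to zero, so the s^(α/2) terms lead, with a coefficient that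
`exists_strictConcave_weight` makes positive. -/
lemma exists_combination_ge {α b : ℝ} (h1 : 1 < α) (h2 : α < 2) (hb0 : 0 < b) (hb1 : b < 1) :
    ∃ w s₀ c : ℝ, 0 < w ∧ w < 1 ∧ 0 < s₀ ∧ 0 < c ∧ ∀ s, 0 < s → s ≤ s₀ → c * s ^ (α / 2) ≤
      w * (∫ z, heatProfile α b z * Real.exp (-s * z ^ 2)) -
        (1 + w) * (∫ z, heatProfile α b z * Real.exp (-(2 * s) * z ^ 2)) +
        (∫ z, heatProfile α b z * Real.exp (-(3 * s) * z ^ 2)) := by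
  obtain ⟨w, hw0, hw1, hd⟩ := exists_strictConcave_weight (a := α / 2) (by linarith) (by linarith)
  have hκ0 : 0 < (Real.Gamma (1 + b))⁻¹ := inv_pos.mpr (Real.Gamma_pos_of_pos (by linarith))
  have hM1 := gaussianMoment_pos (q := α) (by linarith)
  have hM2 := gaussianMoment_pos (q := 2 * α) (by linarith)
  obtain ⟨c₁, hc₁⟩ : ∃ c, c = (Real.Gamma (1 + b))⁻¹ * gaussianMoment α := ⟨_, rfl⟩
  obtain ⟨c₂, hc₂⟩ : ∃ c, c = (Real.Gamma (1 + b))⁻¹ ^ 2 * gaussianMoment (2 * α) := ⟨_, rfl⟩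
  have hc₁0 : 0 < c₁ := by rw [hc₁]; positivity
  have hc₂0 : 0 < c₂ := by rw [hc₂]; positivity
  obtain ⟨d, hd'⟩ : ∃ d : ℝ, d = (1 + w) * 2 ^ (α / 2) - w - 3 ^ (α / 2) := ⟨_, rfl⟩
  rw [← hd'] at hd
  obtain ⟨K, hK⟩ : ∃ K : ℝ, K = c₂ * (w + (1 + w) * 2 ^ α + 3 ^ α) := ⟨_, rfl⟩
  have hK0 : 0 < K := by rw [hK]; positivity
  have hα : α ≠ 0 := by linarith
  -- Below this s₀ the remainder K s^α costs at most half of the leading term c₁ d s^(α/2).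
  refine ⟨w, (c₁ * d / (2 * K)) ^ (2 / α), c₁ * d / 2, hw0, hw1, by positivity, by positivity,
    fun s hs hss => ?_⟩
  have hsa : s ^ (α / 2) * K ≤ c₁ * d / 2 := by
    have h := Real.rpow_le_rpow hs.le hss (show 0 ≤ α / 2 by linarith)
    rw [← Real.rpow_mul (by positivity), show 2 / α * (α / 2) = 1 by field_simp,
      Real.rpow_one] at h
    calc _ ≤ c₁ * d / (2 * K) * K := by gcongr
      _ = _ := by field_simp
  have b1 := (abs_le.mp (abs_integral_heatProfile_sub_le h1 hb0 hb1 hs)).1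
  have b2 := (abs_le.mp (abs_integral_heatProfile_sub_le h1 hb0 hb1
    (s := 2 * s) (by positivity))).2
  have b3 := (abs_le.mp (abs_integral_heatProfile_sub_le h1 hb0 hb1
    (s := 3 * s) (by positivity))).1
  rw [← hc₁, ← hc₂] at b1 b2 b3
  rw [Real.mul_rpow (by norm_num) hs.le, Real.mul_rpow (by norm_num) hs.le] at b2 b3
  have hsplit : s ^ α = s ^ (α / 2) * s ^ (α / 2) := by
    rw [← Real.rpow_add hs]; congr 1; ring
  have m1 := mul_le_mul_of_nonneg_left b1 hw0.le
  have m2 := mul_le_mul_of_nonneg_left b2 (show 0 ≤ 1 + w by linarith)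
  have hk : s ^ α * K ≤ c₁ * d / 2 * s ^ (α / 2) := by
    rw [hsplit, mul_right_comm]
    exact mul_le_mul_of_nonneg_right hsa (by positivity)
  rw [hK] at hk
  have e : c₁ * d * s ^ (α / 2) = c₁ * s ^ (α / 2) * ((1 + w) * 2 ^ (α / 2)) -
      c₁ * s ^ (α / 2) * w - c₁ * s ^ (α / 2) * 3 ^ (α / 2) := by rw [hd']; ring
  generalize (∫ z, heatProfile α b z * Real.exp (-s * z ^ 2)) = θ₁ at *
  generalize (∫ z, heatProfile α b z * Real.exp (-(2 * s) * z ^ 2)) = θ₂ at *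
  generalize (∫ z, heatProfile α b z * Real.exp (-(3 * s) * z ^ 2)) = θ₃ at *
  linarith

/-- The choice s = -log w / y² makes exp(-s y²) = w. Dividing s^(α/2) by √(π/s) gives order
s^((1+α)/2), that is y^(-(1+α)). -/
lemma exists_heatProfile_tail_ge {α b : ℝ} (h1 : 1 < α) (h2 : α < 2) (hb0 : 0 < b) (hb1 : b < 1) :
    ∃ C Y : ℝ, 0 < C ∧ 0 < Y ∧ ∀ y, Y ≤ y → C * ((y ^ 2) ^ ((1 + α) / 2))⁻¹ ≤
      heatProfile α b y := by
  obtain ⟨w, s₀, c, hw0, hw1, hs₀, hc, hcomb⟩ := exists_combination_ge h1 h2 hb0 hb1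
  have hℓ0 : 0 < -Real.log w := by rw [neg_pos]; exact Real.log_neg hw0 hw1
  obtain ⟨ℓ, hℓ⟩ : ∃ ℓ, ℓ = -Real.log w := ⟨_, rfl⟩
  rw [← hℓ] at hℓ0
  have hpi : 0 < Real.sqrt Real.pi := Real.sqrt_pos.mpr Real.pi_pos
  refine ⟨c * ℓ ^ ((1 + α) / 2) / Real.sqrt Real.pi, Real.sqrt (ℓ / s₀), by positivity,
    Real.sqrt_pos.mpr (by positivity), fun y hy => ?_⟩
  have hy0 : 0 < y := (Real.sqrt_pos.mpr (by positivity)).trans_le hy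
  have hs0 : 0 < ℓ / y ^ 2 := by positivity
  have hss : ℓ / y ^ 2 ≤ s₀ := by
    rw [div_le_iff₀ (by positivity), ← div_le_iff₀' hs₀]
    exact (Real.sqrt_le_left hy0.le).mp hy
  have hwy : Real.exp (-(ℓ / y ^ 2) * y ^ 2) = w := by
    rw [neg_mul, div_mul_cancel₀ _ (by positivity), hℓ, neg_neg, Real.exp_log hw0]
  have hlow := (hcomb _ hs0 hss).trans
    (integral_combination_le h1 h2 hb0 hb1 hs0 hw1 hy0.le hwy)
  have hsq : 0 < Real.sqrt (ℓ / y ^ 2) := Real.sqrt_pos.mpr hs0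
  rw [Real.sqrt_div Real.pi_pos.le, ← mul_div_assoc, le_div_iff₀ hsq, ← div_le_iff₀ hpi,
    Real.sqrt_eq_rpow (ℓ / y ^ 2), mul_assoc, ← Real.rpow_add hs0,
    show α / 2 + 1 / 2 = (1 + α) / 2 by ring, Real.div_rpow hℓ0.le (by positivity)] at hlow
  refine le_trans (le_of_eq ?_) hlow
  ring

/-- The heat kernel at time `1` has a polynomial lower bound of order `1 + α`. -/
lemma exists_heatProfile_ge {α b : ℝ} (h1 : 1 < α) (h2 : α < 2) (hb0 : 0 < b) (hb1 : b < 1) :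
    ∃ c : ℝ, 0 < c ∧ ∀ z, c * ((1 + z ^ 2) ^ ((1 + α) / 2))⁻¹ ≤ heatProfile α b z := by
  obtain ⟨C, Y, hC, hY, htail⟩ := exists_heatProfile_tail_ge h1 h2 hb0 hb1
  have hYp : 0 < heatProfile α b Y := lt_of_lt_of_le (by positivity) (htail Y le_rfl)
  refine ⟨min C (heatProfile α b Y), lt_min hC hYp, fun z => ?_⟩
  rw [← heatProfile_abs α b z]
  rcases le_total Y |z| with hz | hz
  · refine le_trans ?_ (htail _ hz)
    have hz0 : 0 < |z| := hY.trans_le hz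
    have hle : (|z| ^ 2) ^ ((1 + α) / 2) ≤ (1 + z ^ 2) ^ ((1 + α) / 2) := by
      rw [sq_abs]
      exact Real.rpow_le_rpow (sq_nonneg _) (by linarith) (by linarith)
    gcongr
    exact min_le_left _ _
  · have hinv : ((1 + z ^ 2) ^ ((1 + α) / 2))⁻¹ ≤ 1 :=
      inv_le_one_of_one_le₀ (Real.one_le_rpow (by nlinarith [sq_nonneg z]) (by linarith))
    calc _ ≤ min C (heatProfile α b Y) * 1 := by gcongr
      _ ≤ heatProfile α b Y := by rw [mul_one]; exact min_le_right _ _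
      _ ≤ _ := heatProfile_antitone h1 h2 hb0 hb1 (abs_nonneg z) hz

/-! ### Lower bounds for the heat kernel at all times -/

lemma refConst_pos {α : ℝ} (h : 0 < α) : 0 < refConst α := by
  have h1 := Real.Gamma_pos_of_pos (show 0 < α / 2 + 1 / 2 by linarith)
  have h2 := Real.Gamma_pos_of_pos (show 0 < α / 2 by linarith)
  have h3 := Real.Gamma_pos_of_pos (show (0 : ℝ) < 1 / 2 by norm_num)
  unfold refConst
  positivity

lemma exists_heatKernel_ge {α b : ℝ} (h1 : 1 < α) (h2 : α < 2) (hb0 : 0 < b) (hb1 : b < 1) :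
    ∃ c : ℝ, 0 < c ∧ ∀ t, 0 < t → ∀ x,
      c * (t ^ b / (t ^ (2 * b / α) + x ^ 2) ^ ((1 + α) / 2)) ≤ heatKernel α b t x := by
  obtain ⟨c, hc0, hc⟩ := exists_heatProfile_ge h1 h2 hb0 hb1
  refine ⟨c, hc0, fun t ht x => ?_⟩
  rw [heatKernel_eq_profile (by linarith) ht]
  have hα : α ≠ 0 := by linarith
  have ht2 : 0 < t ^ (2 * b / α) := by positivity
  have e : t ^ b / (t ^ (2 * b / α) + x ^ 2) ^ ((1 + α) / 2) =
      t ^ (-(b / α)) * ((1 + (x * t ^ (-(b / α))) ^ 2) ^ ((1 + α) / 2))⁻¹ := by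
    have e1 : t ^ (2 * b / α) + x ^ 2 = t ^ (2 * b / α) * (1 + (x * t ^ (-(b / α))) ^ 2) := by
      rw [mul_pow, ← Real.rpow_natCast (t ^ (-(b / α))), ← Real.rpow_mul ht.le, mul_add, mul_one,
        mul_left_comm, ← Real.rpow_add ht]
      push_cast
      rw [show 2 * b / α + -(b / α) * 2 = 0 by ring, Real.rpow_zero, mul_one]
    rw [e1, Real.mul_rpow ht2.le (by positivity), ← Real.rpow_mul ht.le, div_mul_eq_div_div,
      ← Real.rpow_sub ht, div_eq_mul_inv]
    congr 2
    field_simp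
    ring
  rw [e, mul_left_comm]
  exact mul_le_mul_of_nonneg_left (hc _) (by positivity)

/-- Continuity and positivity of the profile at 0 suffice, so α = 2 is included. -/
lemma exists_heatKernel_ge_of_abs_le {α b : ℝ} (h1 : 1 < α) (hb0 : 0 < b) (hb1 : b < 1) :
    ∃ c δ : ℝ, 0 < c ∧ 0 < δ ∧ ∀ t, 0 < t → ∀ x, |x| ≤ δ * t ^ (b / α) →
      c * t ^ (-(b / α)) ≤ heatKernel α b t x := by
  have hp := heatProfile_zero_pos h1 hb0 hb1
  have hc := (continuous_heatProfile h1 hb0 hb1).continuousAt (x := 0)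
  have hev := hc.eventually_const_lt (half_lt_self hp)
  obtain ⟨ε, hε, hball⟩ := Metric.eventually_nhds_iff.mp hev
  refine ⟨heatProfile α b 0 / 2, ε / 2, half_pos hp, half_pos hε, fun t ht x hx => ?_⟩
  rw [heatKernel_eq_profile (by linarith) ht, mul_comm]
  refine mul_le_mul_of_nonneg_left (hball ?_).le (by positivity)
  have hs : 0 < t ^ (b / α) := by positivity
  rw [Real.dist_0_eq_abs, abs_mul, abs_of_pos (by positivity : 0 < t ^ (-(b / α))),
    Real.rpow_neg ht.le, ← div_eq_mul_inv, div_lt_iff₀ hs]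
  nlinarith

open Set

/-! ### Beta integrals and Gamma quotients -/

lemma setLIntegral_beta {p q t : ℝ} (hp : 0 < p) (hq : 0 < q) (ht : 0 < t) :
    ∫⁻ s in Ioo 0 t, ENNReal.ofReal ((t - s) ^ (p - 1) * s ^ (q - 1)) =
      ENNReal.ofReal (Real.Gamma p * Real.Gamma q / Real.Gamma (p + q) * t ^ (p + q - 1)) := by
  have hB := ProbabilityTheory.beta_pos hq hp
  have hF := ProbabilityTheory.lintegral_betaPDF_eq_one hq hp
  have hpt : ∀ s, (Ioo 0 t).indicator
      (fun s => ENNReal.ofReal ((t - s) ^ (p - 1) * s ^ (q - 1))) s =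
      ENNReal.ofReal (ProbabilityTheory.beta q p * t ^ (p + q - 2)) *
        ProbabilityTheory.betaPDF q p (t⁻¹ * s) := by
    intro s
    by_cases hs : s ∈ Ioo 0 t
    · rw [indicator_of_mem hs]
      have h0 : 0 < t⁻¹ * s := mul_pos (inv_pos.mpr ht) hs.1
      have h1 : t⁻¹ * s < 1 := by rw [inv_mul_lt_iff₀ ht, mul_one]; exact hs.2
      rw [ProbabilityTheory.betaPDF_of_pos_lt_one h0 h1, ← ENNReal.ofReal_mul (by positivity)]
      congr 1
      have e : 1 - t⁻¹ * s = t⁻¹ * (t - s) := by field_simp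
      rw [e, Real.mul_rpow (by positivity) hs.1.le, Real.mul_rpow (by positivity)
        (by linarith [hs.2]), show p + q - 2 = (q - 1) + (p - 1) by ring, Real.rpow_add ht,
        Real.inv_rpow ht.le, Real.inv_rpow ht.le]
      have a1 : 0 < t ^ (q - 1) := by positivity
      have a2 : 0 < t ^ (p - 1) := by positivity
      field_simp
    · rw [indicator_of_notMem hs]
      rw [mem_Ioo, not_and_or, not_lt, not_lt] at hs
      rcases hs with h | h
      · rw [ProbabilityTheory.betaPDF_eq_zero_of_nonpos
          (mul_nonpos_of_nonneg_of_nonpos (inv_pos.mpr ht).le h), mul_zero]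
      · rw [ProbabilityTheory.betaPDF_eq_zero_of_one_le
          (by rw [le_inv_mul_iff₀ ht, mul_one]; exact h), mul_zero]
  have hmeas : Measurable (ProbabilityTheory.betaPDF q p) :=
    (ProbabilityTheory.measurable_betaPDFReal q p).ennreal_ofReal
  have hmeas' : Measurable fun s => ProbabilityTheory.betaPDF q p (t⁻¹ * s) :=
    hmeas.comp (measurable_const_mul _)
  rw [← lintegral_indicator measurableSet_Ioo, lintegral_congr hpt, lintegral_const_mul _ hmeas',
    ← lintegral_map hmeas (measurable_const_mul t⁻¹), Real.map_volume_mul_left (by positivity),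
    lintegral_smul_measure, hF, inv_inv, abs_of_pos ht, smul_eq_mul, mul_one,
    ← ENNReal.ofReal_mul (by positivity), ProbabilityTheory.beta]
  congr 1
  rw [show p + q - 1 = (p + q - 2) + 1 by ring, Real.rpow_add ht, Real.rpow_one, add_comm q p]
  ring

lemma Gamma_add_natCast_le {x : ℝ} (hx : 0 < x) (m : ℕ) :
    Real.Gamma (x + m) ≤ (x + m) ^ m * Real.Gamma x := by
  have hG := Real.Gamma_pos_of_pos hx
  induction m with
  | zero => simp
  | succ m ih =>
    push_cast
    rw [← add_assoc, Real.Gamma_add_one (by positivity), pow_succ]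
    calc (x + m) * Real.Gamma (x + m) ≤ (x + m + 1) * ((x + m + 1) ^ m * Real.Gamma x) := by
          refine mul_le_mul (by linarith) (ih.trans ?_) (Real.Gamma_pos_of_pos (by positivity)).le
            (by positivity)
          exact mul_le_mul_of_nonneg_right (pow_le_pow_left₀ (by positivity) (by linarith) m) hG.le
      _ = _ := by ring

/-- Log-convexity of Γ interpolates between x and x + m. -/
lemma Gamma_add_le {x D : ℝ} {m : ℕ} (hx : 0 < x) (hD : 0 ≤ D) (hm : 0 < m) (hDm : D ≤ m) :
    Real.Gamma (x + D) ≤ (x + m) ^ m * Real.Gamma x := by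
  have hG := Real.Gamma_pos_of_pos hx
  have hm0 : (0 : ℝ) < m := by exact_mod_cast hm
  have hm1 : (1 : ℝ) ≤ m := by exact_mod_cast hm
  have hθ1 : D / m ≤ 1 := by rw [div_le_one hm0]; exact hDm
  rcases hD.eq_or_lt with rfl | hD0
  · rw [add_zero]
    exact le_mul_of_one_le_left hG.le (one_le_pow₀ (by linarith))
  rcases hDm.eq_or_lt with rfl | hDm
  · exact Gamma_add_natCast_le hx m
  have h := Real.Gamma_mul_add_mul_le_rpow_Gamma_mul_rpow_Gamma (s := x) (t := x + m)
    (a := 1 - D / m) (b := D / m) hx (by positivity)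
    (by rw [sub_pos, div_lt_one hm0]; exact hDm) (by positivity) (by ring)
  rw [show (1 - D / m) * x + D / m * (x + m) = x + D by field_simp; ring] at h
  refine h.trans ?_
  calc _ ≤ Real.Gamma x ^ (1 - D / m) * ((x + m) ^ m * Real.Gamma x) ^ (D / m) := by
        have := Gamma_add_natCast_le hx m
        have := (Real.Gamma_pos_of_pos (show 0 < x + m by positivity)).le
        gcongr
    _ = ((x + m) ^ m) ^ (D / m) * Real.Gamma x := by
        rw [Real.mul_rpow (by positivity) hG.le, mul_left_comm, ← Real.rpow_add hG,
          sub_add_cancel, Real.rpow_one]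
    _ ≤ ((x + m) ^ m) ^ (1 : ℝ) * Real.Gamma x := by
        gcongr
        exact one_le_pow₀ (by linarith)
    _ = _ := by rw [Real.rpow_one]

/-- A fixed shift of the argument costs a power of n, which n + 1 ≤ 2^n turns into a geometric
factor. -/
lemma exists_Gamma_add_le {e D : ℝ} (he : 0 < e) (hD : 0 ≤ D) :
    ∃ M K : ℝ, 0 < M ∧ 0 < K ∧ ∀ n : ℕ,
      Real.Gamma (e * n + e + D) ≤ M * K ^ n * Real.Gamma (e * n + e) := by
  obtain ⟨m, hm⟩ := exists_nat_ge D
  refine ⟨(e + ((m + 1 : ℕ) : ℝ)) ^ (m + 1), 2 ^ (m + 1), by positivity, by positivity,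
    fun n => ?_⟩
  have hx : 0 < e * n + e := by positivity
  refine (Gamma_add_le (m := m + 1) hx hD (by omega) (hm.trans (by push_cast; linarith))).trans ?_
  have hG := Real.Gamma_pos_of_pos hx
  refine mul_le_mul_of_nonneg_right ?_ hG.le
  rw [← pow_mul, mul_comm (m + 1) n, pow_mul, ← mul_pow]
  refine pow_le_pow_left₀ (by positivity) ?_ _
  have h2 : (n : ℝ) + 1 ≤ 2 ^ n := by exact_mod_cast Nat.lt_two_pow_self
  have hm0 : (0 : ℝ) ≤ ((m + 1 : ℕ) : ℝ) := by positivity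
  have hn0 : (0 : ℝ) ≤ n := by positivity
  calc e * n + e + ((m + 1 : ℕ) : ℝ) ≤ (e + ((m + 1 : ℕ) : ℝ)) * (n + 1) := by nlinarith
    _ ≤ _ := by gcongr

/-- Termwise comparison. If the real series were not summable its `tsum` would be 0, so no
convergence proof is needed. -/
lemma ofReal_mul_mittagLeffler_le {A μ ν z : ℝ} (hA : 0 ≤ A) (hμ : 0 < μ) (hν : 0 < ν) (hz : 0 ≤ z)
    {T : ℕ → ℝ≥0∞} (hT : ∀ n : ℕ, ENNReal.ofReal (A * (z ^ n / Real.Gamma (μ * n + ν))) ≤ T n) :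
    ENNReal.ofReal (A * mittagLeffler μ ν z) ≤ ∑' n, T n := by
  by_cases hs : Summable fun n : ℕ => z ^ n / Real.Gamma (μ * n + ν)
  · rw [mittagLeffler, ← tsum_mul_left, ENNReal.ofReal_tsum_of_nonneg _ (hs.mul_left A)]
    · exact ENNReal.tsum_le_tsum hT
    · intro n
      have := Real.Gamma_pos_of_pos (show 0 < μ * n + ν by positivity)
      positivity
  · rw [mittagLeffler, tsum_eq_zero_of_not_summable hs]
    simp

/-! ### Pointwise lower bound of the resolvent kernel -/

/-- The spatial profile of the squared lower reference kernel. -/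
def refWeight (α b t x : ℝ) : ℝ := ((t ^ (2 * b / α) + x ^ 2) ^ (1 + α))⁻¹

lemma refWeight_nonneg {α b t : ℝ} (ht : 0 < t) (x : ℝ) : 0 ≤ refWeight α b t x := by
  unfold refWeight; positivity

lemma refWeight_ge_of_lt {α b s t x y : ℝ} (hα : 0 < α) (hb : 0 < b) (hs : 0 < s) (hst : s < t)
    (hy : |y| ≤ s ^ (b / α)) :
    (3 ^ (1 + α))⁻¹ * refWeight α b t x ≤ refWeight α b (t - s) (x - y) := by
  have hts : 0 < t - s := by linarith
  have ht : 0 < t := by linarith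
  have hy2 : y ^ 2 ≤ s ^ (2 * b / α) := by
    rw [← sq_abs, show 2 * b / α = b / α * (2 : ℕ) by push_cast; ring, Real.rpow_mul hs.le,
      Real.rpow_natCast]
    gcongr
  have e0 : 0 ≤ 2 * b / α := by positivity
  have m1 : (t - s) ^ (2 * b / α) ≤ t ^ (2 * b / α) :=
    Real.rpow_le_rpow hts.le (by linarith) e0
  have m2 : s ^ (2 * b / α) ≤ t ^ (2 * b / α) := Real.rpow_le_rpow hs.le hst.le e0
  have m3 : (t - s) ^ (2 * b / α) + (x - y) ^ 2 ≤ 3 * (t ^ (2 * b / α) + x ^ 2) := by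
    nlinarith [sq_nonneg (x + y), sq_nonneg x]
  rw [refWeight, refWeight, ← mul_inv, ← Real.mul_rpow (by norm_num) (by positivity)]
  gcongr

lemma refWeight_ge_of_abs_le {α b s y : ℝ} (hα : 0 < α) (hs : 0 < s)
    (hy : |y| ≤ s ^ (b / α)) :
    (2 ^ (1 + α))⁻¹ * s ^ (-(2 * (b / α) + 2 * b)) ≤ refWeight α b s y := by
  have hy2 : y ^ 2 ≤ s ^ (2 * b / α) := by
    rw [← sq_abs, show 2 * b / α = b / α * (2 : ℕ) by push_cast; ring, Real.rpow_mul hs.le,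
      Real.rpow_natCast]
    gcongr
  rw [show 2 * (b / α) + 2 * b = 2 * b / α * (1 + α) by field_simp, Real.rpow_neg hs.le,
    Real.rpow_mul hs.le, ← mul_inv, ← Real.mul_rpow (by norm_num) (by positivity), refWeight]
  gcongr
  linarith

/-- One convolution step with the squared lower reference kernel. -/
lemma stConv_ge {α b C A r : ℝ} (hα : 1 < α) (hb0 : 0 < b) (hb1 : b < 1) (hA : 0 ≤ A) (hC : 0 ≤ C)
    (hr : 0 ≤ r) {f g : ℝ → ℝ → ℝ≥0∞}
    (hf : ∀ t, 0 < t → ∀ x, ENNReal.ofReal (A * t ^ r * refWeight α b t x) ≤ f t x)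
    (hg : ∀ t, 0 < t → ∀ x, ENNReal.ofReal (C * t ^ (2 * b) * refWeight α b t x) ≤ g t x)
    {t : ℝ} (ht : 0 < t) (x : ℝ) :
    ENNReal.ofReal (2 * A * C * (6 ^ (1 + α))⁻¹ * (Real.Gamma (r + 1) * Real.Gamma (1 - b / α) /
      Real.Gamma (r + 1 + (1 - b / α))) * t ^ (r + (1 - b / α)) * refWeight α b t x) ≤
      stConv f g t x := by
  have hσ : b / α < 1 := by rw [div_lt_one (by linarith)]; linarith
  have hW := refWeight_nonneg (α := α) (b := b) ht x
  set W := refWeight α b t x with hWdef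
  have hL : 0 ≤ 2 * A * C * (6 ^ (1 + α))⁻¹ * W := by positivity
  have key : ∀ s ∈ Ioo 0 t, ENNReal.ofReal (2 * A * C * (6 ^ (1 + α))⁻¹ * W) *
      ENNReal.ofReal ((t - s) ^ (r + 1 - 1) * s ^ (1 - b / α - 1)) ≤
      ∫⁻ y : ℝ, f (t - s) (x - y) * g s y := by
    intro s hs
    have hs0 : 0 < s := hs.1
    have hts : 0 < t - s := by linarith [hs.2]
    -- Only |y| ≤ s^(b/α) is kept: there the shifted weight loses at most 3^(1+α) and the second
    -- weight is comparable to its peak. The interval length 2 s^(b/α) then leaves the power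
    -- s^(-b/α).
    have hpt : ∀ y ∈ Icc (-(s ^ (b / α))) (s ^ (b / α)),
        ENNReal.ofReal (A * (t - s) ^ r * ((3 ^ (1 + α))⁻¹ * W) *
          (C * s ^ (2 * b) * ((2 ^ (1 + α))⁻¹ * s ^ (-(2 * (b / α) + 2 * b))))) ≤
        f (t - s) (x - y) * g s y := by
      intro y hy
      have hy' : |y| ≤ s ^ (b / α) := abs_le.mpr hy
      rw [ENNReal.ofReal_mul (by positivity)]
      refine mul_le_mul' (le_trans (ENNReal.ofReal_le_ofReal ?_) (hf _ hts _))
        (le_trans (ENNReal.ofReal_le_ofReal ?_) (hg _ hs0 _))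
      · exact mul_le_mul_of_nonneg_left
          (refWeight_ge_of_lt (by linarith) hb0 hs0 hs.2 hy') (by positivity)
      · exact mul_le_mul_of_nonneg_left (refWeight_ge_of_abs_le (by linarith) hs0 hy')
          (by positivity)
    refine le_trans (le_of_eq ?_) ((setLIntegral_mono' measurableSet_Icc hpt).trans
      (setLIntegral_le_lintegral _ _))
    rw [setLIntegral_const, Real.volume_Icc, ← ENNReal.ofReal_mul hL,
      ← ENNReal.ofReal_mul (by positivity)]
    congr 1
    rw [show (6 : ℝ) = 3 * 2 by norm_num, Real.mul_rpow (by norm_num) (by norm_num),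
      add_sub_cancel_right, show 1 - b / α - 1 = 2 * b + (-(2 * (b / α) + 2 * b) + b / α) by ring,
      Real.rpow_add hs0, Real.rpow_add hs0]
    ring
  rw [stConv]
  refine le_trans (le_of_eq ?_) (setLIntegral_mono' measurableSet_Ioo key)
  rw [lintegral_const_mul' _ _ ENNReal.ofReal_ne_top,
    setLIntegral_beta (by linarith) (by linarith) ht, ← ENNReal.ofReal_mul hL]
  congr 1
  rw [show r + 1 + (1 - b / α) - 1 = r + (1 - b / α) by ring]
  ring

lemma stConvPow_ge {α b C : ℝ} (hα : 1 < α) (hb0 : 0 < b) (hb1 : b < 1) (hC : 0 ≤ C)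
    {g : ℝ → ℝ → ℝ≥0∞}
    (hg : ∀ t, 0 < t → ∀ x, ENNReal.ofReal (C * t ^ (2 * b) * refWeight α b t x) ≤ g t x) (n : ℕ) :
    ∀ t, 0 < t → ∀ x, ENNReal.ofReal (C * (2 * C * (6 ^ (1 + α))⁻¹ * Real.Gamma (1 - b / α)) ^ n *
      (Real.Gamma (2 * b + 1) / Real.Gamma (2 * b + n * (1 - b / α) + 1)) *
      t ^ (2 * b + n * (1 - b / α)) * refWeight α b t x) ≤ stConvPow g n t x := by
  have hσ : b / α < 1 := by rw [div_lt_one (by linarith)]; linarith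
  have he : 0 < 1 - b / α := by linarith
  have hGe := Real.Gamma_pos_of_pos he
  have hG1 := Real.Gamma_pos_of_pos (show 0 < 2 * b + 1 by linarith)
  induction n with
  | zero =>
    intro t ht x
    simpa [div_self hG1.ne', stConvPow] using hg t ht x
  | succ n ih =>
    intro t ht x
    have hGn := Real.Gamma_pos_of_pos (show 0 < 2 * b + n * (1 - b / α) + 1 by positivity)
    have h := stConv_ge hα hb0 hb1 (by positivity) hC (by positivity) ih hg ht x
    refine le_trans (le_of_eq ?_) h
    congr 1
    rw [show 2 * b + ((n + 1 : ℕ) : ℝ) * (1 - b / α) + 1 =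
      2 * b + n * (1 - b / α) + 1 + (1 - b / α) by push_cast; ring,
      show 2 * b + ((n + 1 : ℕ) : ℝ) * (1 - b / α) = 2 * b + n * (1 - b / α) + (1 - b / α) by
        push_cast; ring, pow_succ]
    generalize Real.Gamma (2 * b + n * (1 - b / α) + 1) = Γn at *
    generalize Real.Gamma (1 - b / α) = Γe at *
    generalize Real.Gamma (2 * b + n * (1 - b / α) + 1 + (1 - b / α)) = Γm at *
    field_simp

lemma refKernel_sq (α b : ℝ) {t : ℝ} (ht : 0 < t) (x : ℝ) :
    refKernel α b t x ^ 2 = refConst α ^ 2 * t ^ (2 * b) * refWeight α b t x := by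
  have h0 : 0 ≤ t ^ (2 * b / α) + x ^ 2 := by positivity
  rw [refKernel, refWeight, div_pow, mul_pow, ← Real.rpow_natCast (t ^ b), ← Real.rpow_mul ht.le,
    ← Real.rpow_natCast ((t ^ (2 * b / α) + x ^ 2) ^ ((1 + α) / 2)), ← Real.rpow_mul h0,
    div_eq_mul_inv]
  push_cast
  rw [mul_comm b 2, div_mul_cancel₀ _ (two_ne_zero)]

/-- Pointwise lower bound of the resolvent kernel. -/
lemma exists_resolventKernel_ge {α b : ℝ} (h1 : 1 < α) (h2 : α < 2) (hb0 : 0 < b) (hb1 : b < 1) :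
    ∃ c ψ₀ : ℝ, 0 < c ∧ 0 < ψ₀ ∧ ∀ ψ, 0 < ψ → ψ ≤ ψ₀ → ∀ l t : ℝ, 0 < t → ∀ x,
      ENNReal.ofReal ((c * l ^ 2) * refKernel α b t x ^ 2 *
        mittagLeffler (1 - b / α) (1 - b / α) ((ψ * l ^ 2) * t ^ (1 - b / α))) ≤
      resolventKernel α b l t x := by
  have hσ : b / α < 1 := by rw [div_lt_one (by linarith)]; linarith
  obtain ⟨c₀, hc₀, hG⟩ := exists_heatKernel_ge h1 h2 hb0 hb1
  obtain ⟨e, he⟩ : ∃ e, e = 1 - b / α := ⟨_, rfl⟩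
  have he0 : 0 < e := by linarith
  have he1 : e < 1 := by
    have : 0 < b / α := by positivity
    linarith
  -- The shift 2b + 1 - e leads from the argument en + e of the target series to 2b + ne + 1,
  -- produced by the convolutions.
  obtain ⟨M, K, hM, hK, hMK⟩ := exists_Gamma_add_le he0 (show 0 ≤ 2 * b + 1 - e by linarith)
  have hR := refConst_pos (show 0 < α by linarith)
  have hGe := Real.Gamma_pos_of_pos he0
  have hG1 := Real.Gamma_pos_of_pos (show 0 < 2 * b + 1 by linarith)
  have hg : ∀ t, 0 < t → ∀ x, ENNReal.ofReal (c₀ ^ 2 * t ^ (2 * b) * refWeight α b t x) ≤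
      ENNReal.ofReal (heatKernel α b t x ^ 2) := by
    intro t ht x
    refine ENNReal.ofReal_le_ofReal ?_
    have hr := refKernel_sq α b ht x
    have hkey : c₀ ^ 2 * t ^ (2 * b) * refWeight α b t x =
        (c₀ * (t ^ b / (t ^ (2 * b / α) + x ^ 2) ^ ((1 + α) / 2))) ^ 2 := by
      rw [refKernel, mul_div_assoc, mul_pow, mul_assoc] at hr
      rw [mul_pow, mul_left_cancel₀ (by positivity) hr]
      ring
    rw [hkey]
    exact pow_le_pow_left₀ (by positivity) (hG t ht x) 2
  obtain ⟨A, hA⟩ : ∃ A, A = 2 * c₀ ^ 2 * (6 ^ (1 + α))⁻¹ * Real.Gamma e := ⟨_, rfl⟩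
  have hA0 : 0 < A := by rw [hA]; positivity
  -- M and the normalization of `refKernel` enter the prefactor; the geometric loss K enters ψ₀.
  refine ⟨c₀ ^ 2 * Real.Gamma (2 * b + 1) / (M * refConst α ^ 2), A / K, by positivity,
    by positivity, fun ψ hψ hψ₀ l t ht x => ?_⟩
  rw [← he]
  refine ofReal_mul_mittagLeffler_le (by positivity) he0 he0 (by positivity) fun n => ?_
  refine le_trans ?_ (mul_le_mul' le_rfl (stConvPow_ge h1 hb0 hb1 (sq_nonneg c₀) hg n t ht x))
  rw [← ENNReal.ofReal_mul (Even.pow_nonneg (even_two_mul _) l), refKernel_sq α b ht x, ← he,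
    ← hA]
  refine ENNReal.ofReal_le_ofReal ?_
  have hGn := Real.Gamma_pos_of_pos (show 0 < e * n + e by positivity)
  have hGn2 := Real.Gamma_pos_of_pos (show 0 < 2 * b + n * e + 1 by positivity)
  have hW := refWeight_nonneg (α := α) (b := b) ht x
  have hGG := hMK n
  rw [show e * n + e + (2 * b + 1 - e) = 2 * b + n * e + 1 by ring] at hGG
  have hψn : ψ ^ n ≤ A ^ n / K ^ n := by
    rw [← div_pow]; exact pow_le_pow_left₀ hψ.le hψ₀ n
  have hte : (t ^ e) ^ n = t ^ (n * e) := by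
    rw [mul_comm, Real.rpow_mul ht.le, Real.rpow_natCast]
  have hl : l ^ (2 * (n + 1)) = l ^ 2 * (l ^ 2) ^ n := by rw [← pow_mul]; ring
  rw [Real.rpow_add ht, mul_pow, mul_pow, hte, hl]
  have hcore : ψ ^ n / (M * Real.Gamma (e * n + e)) ≤ A ^ n / Real.Gamma (2 * b + n * e + 1) := by
    rw [div_le_div_iff₀ (by positivity) hGn2]
    calc ψ ^ n * Real.Gamma (2 * b + n * e + 1)
        ≤ (A ^ n / K ^ n) * (M * K ^ n * Real.Gamma (e * n + e)) := by gcongr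
      _ = _ := by field_simp
  have hP : 0 ≤ c₀ ^ 2 * Real.Gamma (2 * b + 1) * l ^ 2 * (l ^ 2) ^ n * t ^ (2 * b) *
      t ^ (n * e) * refWeight α b t x := by positivity
  have hfin := mul_le_mul_of_nonneg_left hcore hP
  refine le_trans (le_of_eq ?_) (hfin.trans (le_of_eq ?_))
  · field_simp
  · ring

/-! ### Space-time mass of the resolvent kernel -/

lemma stConvPow_mono {f g : ℝ → ℝ → ℝ≥0∞} (h : ∀ t, 0 < t → ∀ x, f t x ≤ g t x) (n : ℕ) :
    ∀ t, 0 < t → ∀ x, stConvPow f n t x ≤ stConvPow g n t x := by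
  induction n with
  | zero => exact h
  | succ n ih =>
    intro t ht x
    refine setLIntegral_mono' measurableSet_Ioo fun s hs => lintegral_mono fun y => ?_
    exact mul_le_mul' (ih _ (by linarith [hs.2]) _) (h _ hs.1 _)

lemma measurable_stConv {f g : ℝ → ℝ → ℝ≥0∞} (hf : Measurable (Function.uncurry f))
    (hg : Measurable (Function.uncurry g)) : Measurable (Function.uncurry (stConv f g)) := by
  have h1 : Measurable fun q : ((ℝ × ℝ) × ℝ) × ℝ =>
      f (q.1.1.1 - q.1.2) (q.1.1.2 - q.2) * g q.1.2 q.2 :=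
    (hf.comp (by fun_prop : Measurable fun q : ((ℝ × ℝ) × ℝ) × ℝ =>
      (q.1.1.1 - q.1.2, q.1.1.2 - q.2))).mul (hg.comp (by fun_prop : Measurable
        fun q : ((ℝ × ℝ) × ℝ) × ℝ => (q.1.2, q.2)))
  have h2 : Measurable fun q : (ℝ × ℝ) × ℝ => ∫⁻ y : ℝ, f (q.1.1 - q.2) (q.1.2 - y) * g q.2 y :=
    h1.lintegral_prod_right'
  have hS : MeasurableSet {q : (ℝ × ℝ) × ℝ | q.2 ∈ Ioo 0 q.1.1} :=
    (measurableSet_lt measurable_const measurable_snd).inter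
      (measurableSet_lt measurable_snd (measurable_fst.comp measurable_fst))
  have h3 := (h2.indicator hS).lintegral_prod_right' (ν := volume)
  refine (congrArg Measurable (funext fun p => ?_)).mp h3
  simp only [Function.uncurry, stConv]
  rw [← lintegral_indicator measurableSet_Ioo]
  rfl

lemma measurable_stConvPow {f : ℝ → ℝ → ℝ≥0∞} (hf : Measurable (Function.uncurry f)) (n : ℕ) :
    Measurable (Function.uncurry (stConvPow f n)) := by
  induction n with
  | zero => exact hf
  | succ n ih => exact measurable_stConv ih hf

/-- Tonelli and translation invariance reduce the spatial mass to a convolution in time alone. -/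
lemma lintegral_stConv {f g : ℝ → ℝ → ℝ≥0∞} (hf : Measurable (Function.uncurry f))
    (hg : Measurable (Function.uncurry g)) (t : ℝ) :
    ∫⁻ x, stConv f g t x = ∫⁻ s in Ioo 0 t, (∫⁻ x, f (t - s) x) * ∫⁻ y, g s y := by
  have h1 : Measurable fun q : (ℝ × ℝ) × ℝ => f (t - q.1.2) (q.1.1 - q.2) * g q.1.2 q.2 :=
    (hf.comp (by fun_prop : Measurable fun q : (ℝ × ℝ) × ℝ =>
      (t - q.1.2, q.1.1 - q.2))).mul (hg.comp (by fun_prop : Measurable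
        fun q : (ℝ × ℝ) × ℝ => (q.1.2, q.2)))
  simp only [stConv]
  rw [lintegral_lintegral_swap h1.lintegral_prod_right'.aemeasurable]
  refine lintegral_congr fun s => ?_
  have hfs : Measurable fun x => f (t - s) x := hf.of_uncurry_left
  have hgs : Measurable fun y => g s y := hg.of_uncurry_left
  rw [lintegral_lintegral_swap (by
    exact (Measurable.mul (hfs.comp (by fun_prop)) (hgs.comp (by fun_prop))).aemeasurable)]
  rw [← lintegral_const_mul _ hgs]
  refine lintegral_congr fun y => ?_
  have hfy : Measurable fun x => f (t - s) (x - y) := hfs.comp (measurable_sub_const y)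
  rw [lintegral_mul_const _ hfy,
    lintegral_sub_right_eq_self (fun x => f (t - s) x) y]

/-- The masses are pure powers of t, so the iterated Beta integrals telescope exactly and no Gamma
comparison is needed. -/
lemma lintegral_stConvPow {f : ℝ → ℝ → ℝ≥0∞} (hf : Measurable (Function.uncurry f)) {B e : ℝ}
    (hB : 0 ≤ B) (he : 0 < e)
    (hm : ∀ t, 0 < t → ∫⁻ x, f t x = ENNReal.ofReal (B * t ^ (e - 1))) (n : ℕ) :
    ∀ t, 0 < t → ∫⁻ x, stConvPow f n t x = ENNReal.ofReal
      ((B * Real.Gamma e) ^ (n + 1) / Real.Gamma ((n + 1) * e) * t ^ ((n + 1) * e - 1)) := by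
  have hGe := Real.Gamma_pos_of_pos he
  induction n with
  | zero =>
    intro t ht
    simp only [stConvPow, hm t ht]
    rw [Nat.cast_zero, zero_add, zero_add, one_mul, pow_one, mul_div_cancel_right₀ _ hGe.ne']
  | succ n ih =>
    intro t ht
    have hGn := Real.Gamma_pos_of_pos (show 0 < ((n : ℝ) + 1) * e by positivity)
    simp only [stConvPow]
    rw [lintegral_stConv (measurable_stConvPow hf n) hf]
    have hs : ∀ s ∈ Ioo 0 t, (∫⁻ x, stConvPow f n (t - s) x) * ∫⁻ y, f s y =
        ENNReal.ofReal ((B * Real.Gamma e) ^ (n + 1) / Real.Gamma ((n + 1) * e) * B) *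
          ENNReal.ofReal ((t - s) ^ ((n + 1) * e - 1) * s ^ (e - 1)) := by
      intro s hs
      have hts : 0 < t - s := by linarith [hs.2]
      have hs0 : 0 < s := hs.1
      rw [ih _ hts, hm _ hs0, ← ENNReal.ofReal_mul (by positivity),
        ← ENNReal.ofReal_mul (by positivity)]
      congr 1
      ring
    rw [setLIntegral_congr_fun measurableSet_Ioo hs, lintegral_const_mul' _ _ ENNReal.ofReal_ne_top,
      setLIntegral_beta (by positivity) he ht, ← ENNReal.ofReal_mul (by positivity)]
    congr 1
    rw [show ((n : ℝ) + 1) * e + e = (((n + 1 : ℕ) : ℝ) + 1) * e by push_cast; ring,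
      pow_succ _ (n + 1)]
    field_simp

/-- Lower bound of the space-time mass of the resolvent kernel. -/
lemma exists_stConv_one_resolventKernel_ge {α b : ℝ} (h1 : 1 < α) (hb0 : 0 < b) (hb1 : b < 1) :
    ∃ c ψ₀ : ℝ, 0 < c ∧ 0 < ψ₀ ∧ ∀ ψ, 0 < ψ → ψ ≤ ψ₀ → ∀ l t : ℝ, 0 < t → ∀ x,
      ENNReal.ofReal ((c * l ^ 2) * t ^ (1 - b / α) *
        mittagLeffler (1 - b / α) (2 - b / α) ((ψ * l ^ 2) * t ^ (1 - b / α))) ≤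
      stConv (fun _ _ => 1) (resolventKernel α b l) t x := by
  have hσ : b / α < 1 := by rw [div_lt_one (by linarith)]; linarith
  obtain ⟨c₀, δ, hc₀, hδ, hG⟩ := exists_heatKernel_ge_of_abs_le h1 hb0 hb1
  obtain ⟨e, he⟩ : ∃ e, e = 1 - b / α := ⟨_, rfl⟩
  have he0 : 0 < e := by linarith
  have hGe := Real.Gamma_pos_of_pos he0
  -- Truncating the kernel to the self-similar region gives a measurable minorant f whose mass at
  -- time s is exactly B s^(e-1).
  let S : Set (ℝ × ℝ) := {p | |p.2| ≤ δ * p.1 ^ (b / α)}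
  have hS : MeasurableSet S := measurableSet_le (by fun_prop) (by fun_prop)
  let f : ℝ → ℝ → ℝ≥0∞ := fun s y =>
    S.indicator (fun p => ENNReal.ofReal (c₀ ^ 2 * p.1 ^ (-(2 * (b / α))))) (s, y)
  have hf : Measurable (Function.uncurry f) := by
    have : Measurable (S.indicator fun p : ℝ × ℝ =>
      ENNReal.ofReal (c₀ ^ 2 * p.1 ^ (-(2 * (b / α))))) :=
      Measurable.indicator (by fun_prop) hS
    exact this
  have hfg : ∀ s, 0 < s → ∀ y, f s y ≤ ENNReal.ofReal (heatKernel α b s y ^ 2) := by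
    intro s hs y
    by_cases hy : (s, y) ∈ S
    · simp only [f, indicator_of_mem hy]
      refine ENNReal.ofReal_le_ofReal ?_
      refine le_trans (le_of_eq ?_) (pow_le_pow_left₀ (by positivity) (hG s hs y hy) 2)
      rw [mul_pow, ← Real.rpow_natCast (s ^ _), ← Real.rpow_mul hs.le]
      congr 2
      push_cast
      ring
    · simp only [f, indicator_of_notMem hy]
      exact zero_le
  obtain ⟨B, hB⟩ : ∃ B, B = 2 * δ * c₀ ^ 2 := ⟨_, rfl⟩
  have hB0 : 0 < B := by rw [hB]; positivity
  have hm : ∀ s, 0 < s → ∫⁻ y, f s y = ENNReal.ofReal (B * s ^ (e - 1)) := by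
    intro s hs
    have : ∀ y, f s y = (Icc (-(δ * s ^ (b / α))) (δ * s ^ (b / α))).indicator
        (fun _ => ENNReal.ofReal (c₀ ^ 2 * s ^ (-(2 * (b / α))))) y := by
      intro y
      simp only [f, indicator, S, mem_ofPred_eq, mem_Icc, abs_le]
    rw [lintegral_congr this, lintegral_indicator measurableSet_Icc, setLIntegral_const,
      Real.volume_Icc, ← ENNReal.ofReal_mul (by positivity)]
    congr 1
    rw [he, show 1 - b / α - 1 = -(2 * (b / α)) + b / α by ring, Real.rpow_add hs, hB]
    ring
  refine ⟨B * Real.Gamma e, B * Real.Gamma e, by positivity, by positivity,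
    fun ψ hψ hψ₀ l t ht x => ?_⟩
  have hlow : ∑' n : ℕ, ENNReal.ofReal (l ^ (2 * (n + 1))) *
      ∫⁻ s in Ioo 0 t, ∫⁻ y, stConvPow f n s y ≤ stConv (fun _ _ => 1) (resolventKernel α b l) t x := by
    have hmeas : ∀ n : ℕ, Measurable fun s => ∫⁻ y, stConvPow f n s y := fun n =>
      (measurable_stConvPow hf n).lintegral_prod_right'
    rw [tsum_congr fun n : ℕ => (lintegral_const_mul (ENNReal.ofReal (l ^ (2 * (n + 1))))
      (μ := volume.restrict (Ioo 0 t)) (hmeas n)).symm]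
    rw [← lintegral_tsum fun n => ((hmeas n).const_mul _).aemeasurable]
    refine setLIntegral_mono' measurableSet_Ioo fun s hs => ?_
    have hms : ∀ n : ℕ, Measurable fun y => stConvPow f n s y := fun n =>
      (measurable_stConvPow hf n).of_uncurry_left
    rw [tsum_congr fun n : ℕ =>
      (lintegral_const_mul (ENNReal.ofReal (l ^ (2 * (n + 1)))) (hms n)).symm]
    rw [← lintegral_tsum fun n => ((hms n).const_mul _).aemeasurable]
    refine lintegral_mono fun y => ?_
    rw [one_mul]
    exact ENNReal.tsum_le_tsum fun n => mul_le_mul' le_rfl (stConvPow_mono hfg n s hs.1 y)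
  refine le_trans ?_ hlow
  rw [show 2 - b / α = e + 1 by rw [he]; ring, ← he]
  refine ofReal_mul_mittagLeffler_le (by positivity) he0 (by positivity) (by positivity)
    fun n => ?_
  have hGn := Real.Gamma_pos_of_pos (show 0 < ((n : ℝ) + 1) * e by positivity)
  have hGn1 := Real.Gamma_pos_of_pos (show 0 < 1 + ((n : ℝ) + 1) * e by positivity)
  -- The trivial factor (t - s)^0 puts the time integral into Beta form with p = 1.
  have hs : ∀ s ∈ Ioo 0 t, ∫⁻ y, stConvPow f n s y =
      ENNReal.ofReal ((B * Real.Gamma e) ^ (n + 1) / Real.Gamma ((n + 1) * e)) *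
        ENNReal.ofReal ((t - s) ^ ((1 : ℝ) - 1) * s ^ (((n : ℝ) + 1) * e - 1)) := by
    intro s hs
    rw [lintegral_stConvPow hf hB0.le he0 hm n s hs.1, ← ENNReal.ofReal_mul (by positivity)]
    simp
  rw [setLIntegral_congr_fun measurableSet_Ioo hs, lintegral_const_mul' _ _ ENNReal.ofReal_ne_top,
    setLIntegral_beta one_pos (by positivity) ht, ← ENNReal.ofReal_mul (by positivity),
    ← ENNReal.ofReal_mul (Even.pow_nonneg (even_two_mul _) l)]
  refine ENNReal.ofReal_le_ofReal ?_
  rw [Real.Gamma_one, one_mul, show 1 + ((n : ℝ) + 1) * e - 1 = e + n * e by ring,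
    Real.rpow_add ht, show e * n + (e + 1) = 1 + ((n : ℝ) + 1) * e by ring]
  have hte : (t ^ e) ^ n = t ^ (n * e) := by
    rw [mul_comm, Real.rpow_mul ht.le, Real.rpow_natCast]
  have hl : l ^ (2 * (n + 1)) = l ^ 2 * (l ^ 2) ^ n := by rw [← pow_mul]; ring
  have hψn : ψ ^ n ≤ (B * Real.Gamma e) ^ n := pow_le_pow_left₀ hψ.le hψ₀ n
  rw [mul_pow, mul_pow, hte, hl]
  calc _ ≤ B * Real.Gamma e * l ^ 2 * t ^ e * ((B * Real.Gamma e) ^ n * (l ^ 2) ^ n * t ^ (n * e) /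
        Real.Gamma (1 + (n + 1) * e)) := by gcongr
    _ = _ := by field_simp; ring

end FracHeat

end

theorem proposition3p4 (α β : ℝ) (hα₁ : 1 < α) (hα₂ : α ≤ 2) (hβ₀ : 0 < β) (hβ₁ : β < 1) :
    ∃ cstar ccirc ψ : ℝ, 0 < cstar ∧ 0 < ccirc ∧ 0 < ψ ∧
      ∀ l : ℝ, l ≠ 0 → ∀ t : ℝ, 0 < t → ∀ x : ℝ,
        (α < 2 →
          ENNReal.ofReal ((cstar * l ^ 2) * FracHeat.refKernel α β t x ^ 2 *
              FracHeat.mittagLeffler (1 - β / α) (1 - β / α) ((ψ * l ^ 2) * t ^ (1 - β / α)))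
            ≤ FracHeat.resolventKernel α β l t x) ∧
        ENNReal.ofReal ((ccirc * l ^ 2) * t ^ (1 - β / α) *
              FracHeat.mittagLeffler (1 - β / α) (2 - β / α) ((ψ * l ^ 2) * t ^ (1 - β / α)))
            ≤ FracHeat.stConv (fun _ _ => 1) (FracHeat.resolventKernel α β l) t x := by
  obtain ⟨c₂, ψ₂, hc₂, hψ₂, h₂⟩ := FracHeat.exists_stConv_one_resolventKernel_ge hα₁ hβ₀ hβ₁
  rcases hα₂.lt_or_eq with hα | hα
  · obtain ⟨c₁, ψ₁, hc₁, hψ₁, h₁⟩ := FracHeat.exists_resolventKernel_ge hα₁ hα hβ₀ hβ₁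
    -- Both bounds hold for every smaller positive ψ, so the minimum serves them together.
    have hm : 0 < min ψ₁ ψ₂ := lt_min hψ₁ hψ₂
    exact ⟨c₁, c₂, min ψ₁ ψ₂, hc₁, hc₂, hm, fun l _ t ht x =>
      ⟨fun _ => h₁ _ hm (min_le_left _ _) l t ht x, h₂ _ hm (min_le_right _ _) l t ht x⟩⟩
  -- For α = 2 the pointwise claim is vacuous and its constant 1 is arbitrary.
  · exact ⟨1, c₂, ψ₂, one_pos, hc₂, hψ₂, fun l _ t ht x =>
      ⟨fun h => absurd hα h.ne, h₂ _ hψ₂ le_rfl l t ht x⟩⟩
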